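/- Let $M$ be a compact complex manifold and let $\omega$ be the fundamental form of a (smooth) Hermitian metric $g$ on $M$, i.e. $\omega(\cdot,\cdot)=g(J\cdot,\cdot)$ where $J$ is the complex structure of $M$. Let $\varepsilon>0$, $I=(-\varepsilon,\varepsilon)$, and let $\{M_t\}_{t\in I}$ be a differentiable family of complex manifolds with $M_0=M$ parametrized by $\phi(t)$: that is, $\phi(t)\in\mathcal A^{0,1}(T^{1,0}M)$, $t\in I$, is a family of $(0,1)$-forms on $M$ with values in the holomorphic tangent bundle, smooth in $(t,x)\in I\times M$, with $\phi(0)=0$, such that for each $t\in I$ the forms $\alpha+i_{\phi(t)}\alpha$, with $\alpha$ a $(1,0)$-form of $M$, are the $(1,0)$-forms of an integrable almost complex structure $J_t$ on the differentiable manifold underlying $M$; $M_t$ is this manifold with $J_t$. Here, for $\phi=\xi\otimes V$, the contraction is $i_\phi(\alpha)=\xi\wedge\iota_V\alpha$, extended linearly in $\phi$. A Hermitian metric on $M_t$ with fundamental form $\omega_t$ is called SKT if $\partial_t\overline\partial_t\omega_t=0$, where $\partial_t=\pi_t^{p+1,q}\circ d$ and $\overline\partial_t=\pi_t^{p,q+1}\circ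 d$ on the $(p,q)$-forms of $M_t$; write $\partial=\partial_0$, $\overline\partial=\overline\partial_0$, and $\phi'(0)=\frac{d}{dt}\phi(t)|_{t=0}$. Suppose that there is a family $\{\omega_t\}_{t\in I}$ of $2$-forms, smooth in $(t,x)\in I\times M$, such that $\omega_0=\omega$ and $\omega_t$ is the fundamental form of an SKT metric on $M_t$ for every $t\in I$. Then the $(2,2)$-form $\mathrm{Im}\,\big((\partial\circ i_{\phi'(0)}\circ\partial)(\omega)\big)$ is $\partial$-closed and $\overline\partial$-closed, and its class vanishes in the Bott–Chern cohomology $$H^{2,2}_{BC}(M)=\frac{\ker\partial\cap\ker\overline\partial\cap\mathcal A^{2,2}(M)}{\partial\overline\partial\,\mathcal A^{1,1}(M)} .$$ -/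

import Mathlib

open scoped Manifold ContDiff

noncomputable section

namespace SKT

/-! ### Linear algebra of complex-valued forms on a real vector space with a complex structure -/

section Linear

variable {E : Type*} [NormedAddCommGroup E] [NormedSpace ℂ E] {k : ℕ}

/-- Multiplication by `i`, as a real linear map: the complex structure of a complex vector space. -/
def mulI (E : Type*) [NormedAddCommGroup E] [NormedSpace ℂ E] : E →L[ℝ] E :=
  (Complex.I • ContinuousLinearMap.id ℂ E).restrictScalars ℝ

@[simp] theorem mulI_apply (v : E) : mulI E v = Complex.I • v := rfl

/-- The multilinear map underlying the component of type `(p, k - p)` of a complex-valued `k`-form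
`α`, with respect to the complex structure `J`. -/
def typeProjMultilinear (J : E →L[ℝ] E) (p : ℕ) (α : E [⋀^Fin k]→L[ℝ] ℂ) :
    ContinuousMultilinearMap ℝ (fun _ : Fin k => E) ℂ :=
  ∑ S ∈ Finset.powersetCard p (Finset.univ : Finset (Fin k)), ∑ T : Finset (Fin k),
    ((1 / 2 : ℂ) ^ k * ∏ j ∈ T, (if j ∈ S then -Complex.I else Complex.I)) •
      α.toContinuousMultilinearMap.compContinuousLinearMap
        (fun j => if j ∈ T then J else ContinuousLinearMap.id ℝ E)

theorem typeProjMultilinear_apply (J : E →L[ℝ] E) (p : ℕ) (α : E [⋀^Fin k]→L[ℝ] ℂ)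
    (v : Fin k → E) :
    typeProjMultilinear J p α v =
      ∑ S ∈ Finset.powersetCard p (Finset.univ : Finset (Fin k)), ∑ T : Finset (Fin k),
        ((1 / 2 : ℂ) ^ k * ∏ j ∈ T, (if j ∈ S then -Complex.I else Complex.I)) *
          α (fun j => if j ∈ T then J (v j) else v j) := by
  simp only [typeProjMultilinear, sum_apply, smul_apply, smul_eq_mul,
    ContinuousMultilinearMap.compContinuousLinearMap_apply]
  refine Finset.sum_congr rfl fun S _ => Finset.sum_congr rfl fun T _ => ?_
  congr 1
  refine congrArg α (funext fun j => ?_)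
  split_ifs <;> rfl

theorem typeProjMultilinear_eq_zero (J : E →L[ℝ] E) (p : ℕ) (α : E [⋀^Fin k]→L[ℝ] ℂ)
    (v : Fin k → E) (a b : Fin k) (hv : v a = v b) (hab : a ≠ b) :
    typeProjMultilinear J p α v = 0 := by
  classical
  rw [typeProjMultilinear_apply, ← Finset.sum_product']
  set σ := Equiv.swap a b with hσ
  have hσσ : ∀ j, σ (σ j) = j := fun j => Equiv.swap_apply_self a b j
  have hvσ : ∀ j, v (σ j) = v j := by
    intro j
    by_cases h1 : j = a
    · subst h1; rw [hσ, Equiv.swap_apply_left, hv]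
    · by_cases h2 : j = b
      · subst h2; rw [hσ, Equiv.swap_apply_right, hv]
      · rw [hσ, Equiv.swap_apply_of_ne_of_ne h1 h2]
  have key : ∀ T : Finset (Fin k),
      α (fun j => if j ∈ T.map σ.toEmbedding then J (v j) else v j) =
        - α (fun j => if j ∈ T then J (v j) else v j) := by
    intro T
    refine Eq.trans ?_ (α.toAlternatingMap.map_swap (fun j => if j ∈ T then J (v j) else v j) hab)
    refine congrArg α (funext fun j => ?_)
    have : (j ∈ T.map σ.toEmbedding) ↔ σ j ∈ T := by
      rw [Finset.mem_map_equiv, Equiv.symm_swap]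
    simp only [Function.comp, this, ← hσ, hvσ]
  refine Finset.sum_involution
    (fun x _ => (x.1.map σ.toEmbedding, x.2.map σ.toEmbedding)) ?_ ?_ ?_ ?_
  · rintro ⟨S, T⟩ -
    have h1 : ∀ j, (σ j ∈ S.map σ.toEmbedding) ↔ j ∈ S := fun j => by
      rw [Finset.mem_map_equiv, Equiv.symm_apply_apply]
    simp only [key, Finset.prod_map, Equiv.coe_toEmbedding, h1]
    ring
  · rintro ⟨S, T⟩ - hne heq
    apply hne
    have hT : T.map σ.toEmbedding = T := (Prod.ext_iff.1 heq).2
    have h0 := key T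
    rw [hT] at h0
    have : α (fun j => if j ∈ T then J (v j) else v j) = 0 := by
      linear_combination h0 / 2
    simp only [this, mul_zero]
  · rintro ⟨S, T⟩ h
    simp only [Finset.mem_product, Finset.mem_powersetCard, Finset.mem_univ, and_true] at h ⊢
    exact ⟨Finset.subset_univ _, by rw [Finset.card_map]; exact h.2⟩
  · rintro ⟨S, T⟩ -
    ext j <;> simp [Finset.mem_map_equiv, hσ]

/-- The component `π^{p, k - p} α` of type `(p, k - p)` of a complex-valued `k`-form `α` on a real
vector space with complex structure `J`.  With `v^{1,0} = (v - i J v) / 2`,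
`v^{0,1} = (v + i J v) / 2` and `α` extended complex multilinearly to the complexification,
`π^{p, k - p} α (v_1, …, v_k)` is the sum, over the `p`-element sets `S` of indices, of the values
of `α` on the vectors `v_j^{1,0}` for `j ∈ S` and `v_j^{0,1}` for `j ∉ S`; each of these values is
expanded multilinearly, `T` being the set of the indices where the term with `J v_j` is taken. -/
def typeProj (J : E →L[ℝ] E) (p : ℕ) (α : E [⋀^Fin k]→L[ℝ] ℂ) : E [⋀^Fin k]→L[ℝ] ℂ :=
  { typeProjMultilinear J p α with
    map_eq_zero_of_eq' := fun v a b hv hab => typeProjMultilinear_eq_zero J p α v a b hv hab }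

theorem typeProj_apply (J : E →L[ℝ] E) (p : ℕ) (α : E [⋀^Fin k]→L[ℝ] ℂ) (v : Fin k → E) :
    typeProj J p α v =
      ∑ S ∈ Finset.powersetCard p (Finset.univ : Finset (Fin k)), ∑ T : Finset (Fin k),
        ((1 / 2 : ℂ) ^ k * ∏ j ∈ T, (if j ∈ S then -Complex.I else Complex.I)) *
          α (fun j => if j ∈ T then J (v j) else v j) :=
  typeProjMultilinear_apply J p α v

/-- The multilinear map underlying `substAt A α`. -/
def substMultilinear (A : E →L[ℝ] E) (α : E [⋀^Fin k]→L[ℝ] ℂ) :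
    ContinuousMultilinearMap ℝ (fun _ : Fin k => E) ℂ :=
  ∑ l : Fin k, α.toContinuousMultilinearMap.compContinuousLinearMap
    (fun j => if j = l then A else ContinuousLinearMap.id ℝ E)

theorem substMultilinear_apply (A : E →L[ℝ] E) (α : E [⋀^Fin k]→L[ℝ] ℂ) (v : Fin k → E) :
    substMultilinear A α v = ∑ l : Fin k, α (Function.update v l (A (v l))) := by
  simp only [substMultilinear, sum_apply,
    ContinuousMultilinearMap.compContinuousLinearMap_apply]
  refine Finset.sum_congr rfl fun l _ => congrArg α (funext fun j => ?_)
  by_cases h : j = l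
  · subst h; simp
  · simp [h]

theorem substMultilinear_eq_zero (A : E →L[ℝ] E) (α : E [⋀^Fin k]→L[ℝ] ℂ)
    (v : Fin k → E) (a b : Fin k) (hv : v a = v b) (hab : a ≠ b) :
    substMultilinear A α v = 0 := by
  classical
  rw [substMultilinear_apply, ← Finset.add_sum_erase _ _ (Finset.mem_univ a),
    ← Finset.add_sum_erase _ _ (Finset.mem_erase.2 ⟨hab.symm, Finset.mem_univ b⟩),
    Finset.sum_eq_zero, add_zero]
  · have : Function.update v b (A (v b)) =
        Function.update v a (A (v a)) ∘ Equiv.swap a b := by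
      funext j
      by_cases h1 : j = a
      · subst h1; simp [Function.update_of_ne hab, Function.update_of_ne hab.symm, hv]
      · by_cases h2 : j = b
        · subst h2; simp [hv]
        · simp [Equiv.swap_apply_of_ne_of_ne h1 h2, h1, h2]
    rw [this]
    exact (congrArg _ (α.toAlternatingMap.map_swap _ hab)).trans (add_neg_cancel _)
  · intro l hl
    simp only [Finset.mem_erase, Finset.mem_univ, and_true] at hl
    refine α.map_eq_zero_of_eq _ ?_ hab
    rw [Function.update_of_ne hl.2.symm, Function.update_of_ne hl.1.symm, hv]

/-- The form `(v_1, …, v_k) ↦ ∑_l α (v_1, …, A v_l, …, v_k)`. -/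
def subst (A : E →L[ℝ] E) (α : E [⋀^Fin k]→L[ℝ] ℂ) : E [⋀^Fin k]→L[ℝ] ℂ :=
  { substMultilinear A α with
    map_eq_zero_of_eq' := fun v a b hv hab => substMultilinear_eq_zero A α v a b hv hab }

theorem subst_apply (A : E →L[ℝ] E) (α : E [⋀^Fin k]→L[ℝ] ℂ) (v : Fin k → E) :
    subst A α v = ∑ l : Fin k, α (Function.update v l (A (v l))) :=
  substMultilinear_apply A α v

/-- The contraction `i_φ α` of a complex-valued form `α` on a complex vector space `E` with
`φ ∈ Λ^{0,1} ⊗ E^{1,0}`.  Such a `φ` is given as a conjugate-linear map `E → E`, where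
`w ∈ E` stands for the vector `w^{1,0} = (w - i J w) / 2` of type `(1, 0)`: the tensor
`ξ ⊗ V^{1,0}` is the map `v ↦ ξ(v) V`.  Then
`(i_φ α)(v_1, …, v_k) = ∑_l α (v_1, …, (φ v_l)^{1,0}, …, v_k)`, which is `ξ ∧ ι_{V^{1,0}} α` for
`φ = ξ ⊗ V^{1,0}`. -/
def contractAt (φ : E →L[ℝ] E) (α : E [⋀^Fin k]→L[ℝ] ℂ) : E [⋀^Fin k]→L[ℝ] ℂ :=
  (1 / 2 : ℂ) • (subst φ α - Complex.I • subst (mulI E ∘L φ) α)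

end Linear

/-! ### Differential forms on a manifold -/

theorem mem_transition_source {E M : Type*} [NormedAddCommGroup E] [TopologicalSpace M]
    [ChartedSpace E M] {e : OpenPartialHomeomorph M E} {y : E} (hy : y ∈ e.target) :
    y ∈ (e.symm.trans (chartAt E (e.symm y))).source := by
  simp [hy]

theorem transition_source_mem_nhds {E M : Type*} [NormedAddCommGroup E] [TopologicalSpace M]
    [ChartedSpace E M] {e : OpenPartialHomeomorph M E} {y : E} (hy : y ∈ e.target) :
    (e.symm.trans (chartAt E (e.symm y))).source ∈ nhds y :=
  (e.symm.trans _).open_source.mem_nhds (mem_transition_source hy)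

section Manifold

variable {E : Type*} [NormedAddCommGroup E] [NormedSpace ℂ E]
  {M : Type*} [TopologicalSpace M] [ChartedSpace E M] {k : ℕ}

/-- Complex-valued `k`-forms (not necessarily smooth) on the real manifold underlying a manifold
`M` modelled on the complex vector space `E`.  (The tangent space `TangentSpace 𝓘(ℝ, E) x` of
Mathlib is by definition the vector space `E`, read through the preferred chart at `x`.) -/
abbrev Form (E M : Type*) [NormedAddCommGroup E] [NormedSpace ℂ E] (k : ℕ) : Type _ :=
  M → E [⋀^Fin k]→L[ℝ] ℂ

instance instAddCommGroupForm : AddCommGroup (Form E M k) := Pi.addCommGroup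

instance instModuleForm : Module ℂ (Form E M k) := Pi.module _ _ _

/-- Fields of real endomorphisms of the tangent spaces. -/
abbrev EndField (E M : Type*) [NormedAddCommGroup E] [NormedSpace ℂ E] : Type _ :=
  M → E →L[ℝ] E

/-- The derivative at `y` of the inverse of a chart `e`, a map `E → T_{e⁻¹ y} M`. -/
def chartSymmDeriv (e : OpenPartialHomeomorph M E) (y : E) : E →L[ℝ] E :=
  mfderiv 𝓘(ℝ, E) 𝓘(ℝ, E) e.symm y

/-- The derivative at `x` of a chart `e`, a map `T_x M → E`. -/
def chartDeriv (e : OpenPartialHomeomorph M E) (x : M) : E →L[ℝ] E :=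
  mfderiv 𝓘(ℝ, E) 𝓘(ℝ, E) e x

/-- The expression of a form in a chart `e`: its pullback under the inverse of `e`. -/
def Form.inChart (e : OpenPartialHomeomorph M E) (α : Form E M k) : E → E [⋀^Fin k]→L[ℝ] ℂ :=
  fun y => (α (e.symm y)).compContinuousLinearMap (chartSymmDeriv e y)

/-- The expression of a field of endomorphisms in a chart `e`. -/
def EndField.inChart (e : OpenPartialHomeomorph M E) (A : EndField E M) : E → E →L[ℝ] E :=
  fun y => chartDeriv e (e.symm y) ∘L A (e.symm y) ∘L chartSymmDeriv e y

/-- Smooth (`C^∞`) forms. -/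
def Form.IsSmooth (α : Form E M k) : Prop :=
  ∀ e ∈ atlas E M, ContDiffOn ℝ ∞ (α.inChart e) e.target

/-- Families of forms, parametrized by `t ∈ (-ε, ε)`, which are smooth in `(t, x)`. -/
def IsSmoothFormFamily (ε : ℝ) (α : ℝ → Form E M k) : Prop :=
  ∀ e ∈ atlas E M, ContDiffOn ℝ ∞ (fun z : ℝ × E => (α z.1).inChart e z.2)
    (Set.Ioo (-ε) ε ×ˢ e.target)

/-- Families of fields of endomorphisms, parametrized by `t ∈ (-ε, ε)`, which are smooth in
`(t, x)`. -/
def IsSmoothEndFamily (ε : ℝ) (A : ℝ → EndField E M) : Prop :=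
  ∀ e ∈ atlas E M, ContDiffOn ℝ ∞ (fun z : ℝ × E => (A z.1).inChart e z.2)
    (Set.Ioo (-ε) ε ×ˢ e.target)

/-- The exterior derivative of a form, computed at `x` in the preferred chart at `x`. -/
def extD (α : Form E M k) : Form E M (k + 1) := fun x =>
  (extDeriv (α.inChart (chartAt E x)) (chartAt E x x)).compContinuousLinearMap
    (chartDeriv (chartAt E x) x)

/-- The pointwise imaginary part of a form. -/
def Form.im (α : Form E M k) : Form E M k := fun x =>
  (Complex.ofRealCLM ∘L Complex.imCLM).compContinuousAlternatingMap (α x)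

/-- The complex structure of the complex manifold `M`, as a field of endomorphisms of the real
tangent spaces: multiplication by `i`. -/
def stdJ (E M : Type*) [NormedAddCommGroup E] [NormedSpace ℂ E] : EndField E M :=
  fun _ => mulI E

/-- The component of type `(p, k - p)` of a `k`-form, with respect to an almost complex
structure `J`. -/
def Form.proj (J : EndField E M) (p : ℕ) (α : Form E M k) : Form E M k :=
  fun x => typeProj (J x) p (α x)

/-- The `k`-form `α` is of type `(p, k - p)` with respect to `J`. -/
def Form.IsType (J : EndField E M) (p : ℕ) (α : Form E M k) : Prop :=
  α.proj J p = α

/-- The operator `∂ = π^{p+1,q} ∘ d` on forms of type `(p, q)`, where `q = k - p`. -/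
def del (J : EndField E M) (p : ℕ) (α : Form E M k) : Form E M (k + 1) :=
  (extD α).proj J (p + 1)

/-- The operator `∂̄ = π^{p,q+1} ∘ d` on forms of type `(p, q)`, where `q = k - p`. -/
def delbar (J : EndField E M) (p : ℕ) (α : Form E M k) : Form E M (k + 1) :=
  (extD α).proj J p

/-- The contraction `i_φ α`, for a field `φ` of conjugate-linear endomorphisms. -/
def contract (φ : EndField E M) (α : Form E M k) : Form E M k :=
  fun x => contractAt (φ x) (α x)

/-! ### The operators `∂` and `∂̄` are linear and preserve smoothness -/

theorem contDiff_typeProj (J : E →L[ℝ] E) (p : ℕ) :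
    ContDiff ℝ ∞ (typeProj J p : (E [⋀^Fin k]→L[ℝ] ℂ) → E [⋀^Fin k]→L[ℝ] ℂ) := by
  let L : (E [⋀^Fin k]→L[ℝ] ℂ) →ₗ[ℝ] (E [⋀^Fin k]→L[ℝ] ℂ) :=
    { toFun := typeProj J p
      map_add' := fun α β => by
        ext v
        simp [typeProj_apply, mul_add, Finset.sum_add_distrib]
      map_smul' := fun c α => by
        ext v
        simp only [typeProj_apply, ContinuousAlternatingMap.smul_apply, RingHom.id_apply,
          Finset.smul_sum, mul_smul_comm] }
  have hc : Continuous L := by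
    rw [(ContinuousAlternatingMap.toContinuousMultilinearMapLI
      (𝕜 := ℝ) (E := E) (F := ℂ) (ι := Fin k)).isometry.isEmbedding.isInducing.continuous_iff]
    change Continuous fun α : E [⋀^Fin k]→L[ℝ] ℂ => typeProjMultilinear J p α
    refine continuous_finsetSum _ fun S _ => continuous_finsetSum _ fun T _ => ?_
    refine Continuous.fun_const_smul ?_ _
    exact (ContinuousMultilinearMap.compContinuousLinearMapL
      (fun j => if j ∈ T then J else ContinuousLinearMap.id ℝ E)).continuous.comp
        (ContinuousAlternatingMap.toContinuousMultilinearMapLI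
          (𝕜 := ℝ) (E := E) (F := ℂ) (ι := Fin k)).continuous
  exact (⟨L, hc⟩ : (E [⋀^Fin k]→L[ℝ] ℂ) →L[ℝ] (E [⋀^Fin k]→L[ℝ] ℂ)).contDiff

theorem typeProj_add (J : E →L[ℝ] E) (p : ℕ) (α β : E [⋀^Fin k]→L[ℝ] ℂ) :
    typeProj J p (α + β) = typeProj J p α + typeProj J p β := by
  ext v
  simp [typeProj_apply, mul_add, Finset.sum_add_distrib]

theorem typeProj_smul (J : E →L[ℝ] E) (p : ℕ) (c : ℂ) (α : E [⋀^Fin k]→L[ℝ] ℂ) :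
    typeProj J p (c • α) = c • typeProj J p α := by
  ext v
  simp only [typeProj_apply, ContinuousAlternatingMap.smul_apply, smul_eq_mul, Finset.mul_sum]
  exact Finset.sum_congr rfl fun S _ => Finset.sum_congr rfl fun T _ => by rw [mul_left_comm]

theorem typeProj_zero (J : E →L[ℝ] E) (p : ℕ) :
    typeProj J p (0 : E [⋀^Fin k]→L[ℝ] ℂ) = 0 := by
  ext v
  simp [typeProj_apply]

theorem typeProj_comp (J : E →L[ℝ] E) (p : ℕ) (α : E [⋀^Fin k]→L[ℝ] ℂ) (L : E →L[ℝ] E)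
    (h : ∀ v, L (J v) = J (L v)) :
    typeProj J p (α.compContinuousLinearMap L) = (typeProj J p α).compContinuousLinearMap L := by
  ext v
  simp only [typeProj_apply, ContinuousAlternatingMap.compContinuousLinearMap_apply]
  refine Finset.sum_congr rfl fun S _ => Finset.sum_congr rfl fun T _ => ?_
  congr 1
  refine congrArg α (funext fun j => ?_)
  simp only [Function.comp]
  split_ifs <;> simp [h]

theorem Form.IsSmooth.differentiableAt {α : Form E M k} (hα : α.IsSmooth)
    {e : OpenPartialHomeomorph M E} (he : e ∈ atlas E M) {y : E} (hy : y ∈ e.target) :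
    DifferentiableAt ℝ (α.inChart e) y :=
  ((hα e he).contDiffAt (e.open_target.mem_nhds hy)).differentiableAt (by simp)

theorem Form.isSmooth_zero : (0 : Form E M k).IsSmooth := by
  intro e _
  exact contDiffOn_const (c := (0 : E [⋀^Fin k]→L[ℝ] ℂ))

theorem Form.IsSmooth.add {α β : Form E M k} (hα : α.IsSmooth) (hβ : β.IsSmooth) :
    (α + β).IsSmooth := fun e he => (hα e he).add (hβ e he)

theorem Form.IsSmooth.smul {α : Form E M k} (hα : α.IsSmooth) (c : ℂ) :
    (c • α).IsSmooth := fun e he => (hα e he).const_smul c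

theorem extD_add {α β : Form E M k} (hα : α.IsSmooth) (hβ : β.IsSmooth) :
    extD (α + β) = extD α + extD β := by
  funext x
  have hx := (chartAt E x).map_source (mem_chart_source E x)
  have h := extDeriv_add (hα.differentiableAt (chart_mem_atlas E x) hx)
    (hβ.differentiableAt (chart_mem_atlas E x) hx)
  exact congrArg (fun γ => γ.compContinuousLinearMap (chartDeriv (chartAt E x) x)) h

theorem extD_smul (c : ℂ) (α : Form E M k) : extD (c • α) = c • extD α := by
  funext x
  have h : fderiv ℝ ((c • α).inChart (chartAt E x)) (chartAt E x x) =
      c • fderiv ℝ (α.inChart (chartAt E x)) (chartAt E x x) :=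
    congrFun (fderiv_const_smul_field c (f := α.inChart (chartAt E x))) (chartAt E x x)
  ext v
  simp only [extD, extDeriv, h, Pi.smul_apply, ContinuousAlternatingMap.smul_apply,
    ContinuousAlternatingMap.compContinuousLinearMap_apply,
    ContinuousAlternatingMap.alternatizeUncurryFin_apply, smul_apply, Finset.smul_sum]
  exact Finset.sum_congr rfl fun i _ => smul_comm _ _ _

theorem del_add (p : ℕ) {α β : Form E M k} (hα : α.IsSmooth) (hβ : β.IsSmooth) :
    del (stdJ E M) p (α + β) = del (stdJ E M) p α + del (stdJ E M) p β := by
  funext x; simp only [del, Form.proj, extD_add hα hβ, Pi.add_apply, typeProj_add]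

theorem delbar_add (p : ℕ) {α β : Form E M k} (hα : α.IsSmooth) (hβ : β.IsSmooth) :
    delbar (stdJ E M) p (α + β) = delbar (stdJ E M) p α + delbar (stdJ E M) p β := by
  funext x; simp only [delbar, Form.proj, extD_add hα hβ, Pi.add_apply, typeProj_add]

theorem del_smul (p : ℕ) (c : ℂ) (α : Form E M k) :
    del (stdJ E M) p (c • α) = c • del (stdJ E M) p α := by
  funext x; simp only [del, Form.proj, extD_smul, Pi.smul_apply, typeProj_smul]

theorem delbar_smul (p : ℕ) (c : ℂ) (α : Form E M k) :
    delbar (stdJ E M) p (c • α) = c • delbar (stdJ E M) p α := by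
  funext x; simp only [delbar, Form.proj, extD_smul, Pi.smul_apply, typeProj_smul]

section Charts

variable [IsManifold 𝓘(ℂ, E) ∞ M]

variable (E M) in
theorem isManifold_real : IsManifold 𝓘(ℝ, E) ∞ M := by
  refine isManifold_of_contDiffOn 𝓘(ℝ, E) ∞ M fun e e' he he' => ?_
  have h := (contDiffGroupoid ∞ 𝓘(ℂ, E)).compatible he he'
  simpa using (show ContDiffOn ℂ ∞ _ _ from h.1).restrict_scalars ℝ

theorem contDiffOn_transition {e e' : OpenPartialHomeomorph M E} (he : e ∈ atlas E M)
    (he' : e' ∈ atlas E M) : ContDiffOn ℂ ∞ (e' ∘ e.symm) (e.symm.trans e').source := by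
  have h := (contDiffGroupoid ∞ 𝓘(ℂ, E)).compatible he he'
  simpa using (show ContDiffOn ℂ ∞ _ _ from h.1)

/-- The derivative of a transition map, in terms of the derivatives of the charts. -/
theorem chartDeriv_comp_chartSymmDeriv {e e' : OpenPartialHomeomorph M E} (he : e ∈ atlas E M)
    (he' : e' ∈ atlas E M) {y : E} (hy : y ∈ (e.symm.trans e').source) :
    chartDeriv e' (e.symm y) ∘L chartSymmDeriv e y = fderiv ℝ (e' ∘ e.symm) y := by
  have := isManifold_real E M
  have : IsManifold 𝓘(ℝ, E) 1 M := IsManifold.of_le (n := ∞) (by norm_num)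
  have hy' : y ∈ e.target ∧ e.symm y ∈ e'.source := by simpa using hy
  have h1 := mdifferentiableAt_atlas_symm (I := 𝓘(ℝ, E)) he hy'.1
  have h2 := mdifferentiableAt_atlas (I := 𝓘(ℝ, E)) he' hy'.2
  have h3 := mfderiv_comp y h2 h1
  rw [← mfderiv_eq_fderiv]
  exact h3.symm

theorem chartSymmDeriv_transition {e e' : OpenPartialHomeomorph M E} (he : e ∈ atlas E M)
    (he' : e' ∈ atlas E M) {y : E} (hy : y ∈ (e.symm.trans e').source) :
    chartSymmDeriv e' (e' (e.symm y)) ∘L fderiv ℝ (e' ∘ e.symm) y = chartSymmDeriv e y := by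
  have := isManifold_real E M
  have : IsManifold 𝓘(ℝ, E) 1 M := IsManifold.of_le (n := ∞) (by norm_num)
  have hy' : y ∈ e.target ∧ e.symm y ∈ e'.source := by simpa using hy
  have h := (mdifferentiable_of_mem_atlas (I := 𝓘(ℝ, E)) he').symm_comp_deriv hy'.2
  rw [← chartDeriv_comp_chartSymmDeriv he he' hy, ← ContinuousLinearMap.comp_assoc]
  have h' : chartSymmDeriv e' (e' (e.symm y)) ∘L chartDeriv e' (e.symm y) =
    ContinuousLinearMap.id ℝ E := h
  rw [h', ContinuousLinearMap.id_comp]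

theorem chartDeriv_chartAt (x : M) :
    chartDeriv (chartAt E x) x = ContinuousLinearMap.id ℝ E := by
  have := isManifold_real E M
  have : IsManifold 𝓘(ℝ, E) 1 M := IsManifold.of_le (n := ∞) (by norm_num)
  exact mfderiv_extChartAt_self (I := 𝓘(ℝ, E)) (x := x)

theorem chartSymmDeriv_mulI {e : OpenPartialHomeomorph M E} (he : e ∈ atlas E M) {y : E}
    (hy : y ∈ e.target) (v : E) :
    chartSymmDeriv e y (mulI E v) = mulI E (chartSymmDeriv e y v) := by
  have hs := mem_transition_source hy
  have h := chartDeriv_comp_chartSymmDeriv he (chart_mem_atlas E (e.symm y)) hs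
  rw [chartDeriv_chartAt, ContinuousLinearMap.id_comp] at h
  have hd : DifferentiableAt ℂ (chartAt E (e.symm y) ∘ e.symm) y :=
    ((contDiffOn_transition he (chart_mem_atlas E (e.symm y))).contDiffAt
      (transition_source_mem_nhds hy)).differentiableAt (by simp)
  rw [h, hd.fderiv_restrictScalars ℝ]
  simp

theorem Form.inChart_eq_pullback {e e' : OpenPartialHomeomorph M E} (he : e ∈ atlas E M)
    (he' : e' ∈ atlas E M) (α : Form E M k) {y : E} (hy : y ∈ (e.symm.trans e').source) :
    α.inChart e y = (α.inChart e' ((e' ∘ e.symm) y)).compContinuousLinearMap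
      (fderiv ℝ (e' ∘ e.symm) y) := by
  have hy' : y ∈ e.target ∧ e.symm y ∈ e'.source := by simpa using hy
  have h := chartSymmDeriv_transition he he' hy
  ext v
  simp only [Form.inChart, Function.comp_apply, ← h, e'.left_inv hy'.2,
    ContinuousAlternatingMap.compContinuousLinearMap_apply]
  rfl

theorem minSmoothness_two_le : minSmoothness ℝ 2 ≤ ∞ := by
  rw [minSmoothness_of_isRCLikeNormedField]
  exact ENat.LEInfty.out

/-- The exterior derivative may be computed in any chart. -/
theorem inChart_extD {α : Form E M k} (hα : α.IsSmooth) {e : OpenPartialHomeomorph M E}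
    (he : e ∈ atlas E M) {y : E} (hy : y ∈ e.target) :
    (extD α).inChart e y = extDeriv (α.inChart e) y := by
  have hs := mem_transition_source hy
  have he' := chart_mem_atlas E (e.symm y)
  have hev : α.inChart e =ᶠ[nhds y] fun z =>
      (α.inChart (chartAt E (e.symm y)) ((chartAt E (e.symm y) ∘ e.symm) z)).compContinuousLinearMap
        (fderiv ℝ (chartAt E (e.symm y) ∘ e.symm) z) :=
    Filter.eventuallyEq_of_mem (transition_source_mem_nhds hy)
      fun z hz => Form.inChart_eq_pullback he he' α hz
  have hτ : ContDiffAt ℝ ∞ (chartAt E (e.symm y) ∘ e.symm) y :=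
    ((contDiffOn_transition he he').contDiffAt (transition_source_mem_nhds hy)).restrict_scalars ℝ
  have hd : DifferentiableAt ℝ (α.inChart (chartAt E (e.symm y)))
      ((chartAt E (e.symm y) ∘ e.symm) y) :=
    hα.differentiableAt he' ((chartAt E (e.symm y)).map_source (mem_chart_source E (e.symm y)))
  rw [hev.extDeriv_eq, extDeriv_pullback hd hτ minSmoothness_two_le,
    ← chartDeriv_comp_chartSymmDeriv he he' hs]
  rfl

theorem Form.IsSmooth.extD {α : Form E M k} (hα : α.IsSmooth) : (extD α).IsSmooth := by
  intro e he
  refine ContDiffOn.congr ?_ fun y hy => inChart_extD hα he hy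
  have h : ContDiffOn ℝ ∞ (fderiv ℝ (α.inChart e)) e.target :=
    (hα e he).fderiv_of_isOpen e.open_target (by simp)
  exact (ContinuousAlternatingMap.alternatizeUncurryFinCLM ℝ E ℂ).contDiff.comp_contDiffOn h

theorem Form.IsSmooth.proj {α : Form E M k} (hα : α.IsSmooth) (p : ℕ) :
    (α.proj (stdJ E M) p).IsSmooth := by
  intro e he
  refine ContDiffOn.congr ((contDiff_typeProj (mulI E) p).comp_contDiffOn (hα e he))
    fun y hy => ?_
  exact (typeProj_comp (mulI E) p _ _ fun v => chartSymmDeriv_mulI he hy v).symm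

variable (E M) in
/-- The space `A^{p, k - p}(M)` of smooth forms of type `(p, k - p)` on the complex manifold `M`. -/
def formsOfType (k p : ℕ) : Submodule ℂ (Form E M k) where
  carrier := {α | α.IsSmooth ∧ α.IsType (stdJ E M) p}
  zero_mem' := ⟨Form.isSmooth_zero, by
    funext x; exact typeProj_zero _ p⟩
  add_mem' := fun hα hβ => ⟨hα.1.add hβ.1, by
    funext x
    exact (typeProj_add _ p _ _).trans (congrArg₂ _ (congrFun hα.2 x) (congrFun hβ.2 x))⟩
  smul_mem' := fun c α hα => ⟨hα.1.smul c, by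
    funext x
    exact (typeProj_smul _ p c _).trans (congrArg _ (congrFun hα.2 x))⟩

end Charts

/-! ### Bott–Chern cohomology -/

section BottChern

variable (E M) [IsManifold 𝓘(ℂ, E) ∞ M]

/-- The space of smooth forms `α` of type `(p, k - p)` with `∂α = 0` and `∂̄α = 0`. -/
def bcClosed (k p : ℕ) : Submodule ℂ (Form E M k) where
  carrier := {α | α ∈ formsOfType E M k p ∧
    del (stdJ E M) p α = 0 ∧ delbar (stdJ E M) p α = 0}
  zero_mem' := ⟨zero_mem _,
    by simpa only [zero_smul] using del_smul p 0 (0 : Form E M k),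
    by simpa only [zero_smul] using delbar_smul p 0 (0 : Form E M k)⟩
  add_mem' := fun {α β} hα hβ => ⟨add_mem hα.1 hβ.1,
    by rw [del_add p hα.1.1 hβ.1.1, hα.2.1, hβ.2.1, add_zero],
    by rw [delbar_add p hα.1.1 hβ.1.1, hα.2.2, hβ.2.2, add_zero]⟩
  smul_mem' := fun c α hα => ⟨Submodule.smul_mem _ c hα.1,
    by rw [del_smul, hα.2.1, smul_zero], by rw [delbar_smul, hα.2.2, smul_zero]⟩

/-- The space `∂∂̄ A^{p, k - p}(M)` of forms of type `(p + 1, k - p + 1)`. -/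
def bcExact (k p : ℕ) : Submodule ℂ (Form E M (k + 1 + 1)) where
  carrier := {β | ∃ ψ ∈ formsOfType E M k p, del (stdJ E M) p (delbar (stdJ E M) p ψ) = β}
  zero_mem' := ⟨0, zero_mem _, by
    have h := del_smul (E := E) (M := M) p 0 (delbar (stdJ E M) p (0 : Form E M k))
    rwa [← delbar_smul, zero_smul, zero_smul] at h⟩
  add_mem' := by
    rintro _ _ ⟨ψ, hψ, rfl⟩ ⟨χ, hχ, rfl⟩
    exact ⟨ψ + χ, add_mem hψ hχ, by
      rw [delbar_add p hψ.1 hχ.1]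
      exact del_add p (hψ.1.extD.proj p) (hχ.1.extD.proj p)⟩
  smul_mem' := by
    rintro c _ ⟨ψ, hψ, rfl⟩
    exact ⟨c • ψ, Submodule.smul_mem _ c hψ, by rw [delbar_smul, del_smul]⟩

/-- The Bott–Chern cohomology space `H_BC^{p+1, q+1}(M)` (that is, in positive bidegrees) of the
complex manifold `M`: the quotient of `ker ∂ ∩ ker ∂̄` in `A^{p+1, q+1}(M)` by
`∂∂̄ A^{p, q}(M)`. -/
abbrev BottChern (p q : ℕ) : Type _ :=
  bcClosed E M (p + q + 1 + 1) (p + 1) ⧸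
    (bcExact E M (p + q) p).comap (bcClosed E M (p + q + 1 + 1) (p + 1)).subtype

variable {E M}

/-- The class in `H_BC^{p+1, q+1}(M)` of a form of type `(p + 1, q + 1)` that is `∂`-closed and
`∂̄`-closed. -/
def BottChern.mk {p q : ℕ} (β : Form E M (p + q + 1 + 1))
    (hβ : β ∈ bcClosed E M (p + q + 1 + 1) (p + 1)) : BottChern E M p q :=
  Submodule.Quotient.mk ⟨β, hβ⟩

end BottChern

/-! ### Hermitian metrics and deformations -/

/-- `η` is the (smooth) fundamental form `η(v, w) = g(J v, w)` of a metric `g` on `M` which is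
Hermitian with respect to the almost complex structure `J`. -/
def IsHermitian (J : EndField E M) (η : Form E M 2) : Prop :=
  η.IsSmooth ∧ ∃ g : M → E →L[ℝ] E →L[ℝ] ℝ,
    (∀ x v w, g x v w = g x w v) ∧
    (∀ x v, v ≠ 0 → 0 < g x v v) ∧
    (∀ x v w, g x (J x v) (J x w) = g x v w) ∧
    ∀ x v w, η x ![v, w] = (g x (J x v) w : ℂ)

/-- `η` is the fundamental form of an SKT metric: a Hermitian metric with `∂∂̄η = 0`. -/
def IsSKT (J : EndField E M) (η : Form E M 2) : Prop :=
  IsHermitian J η ∧ del J 1 (delbar J 1 η) = 0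

/-- Integrability of an almost complex structure: `(dα)^{0,2} = 0` for all smooth `α` of
type `(1, 0)`. -/
def IsIntegrable (J : EndField E M) : Prop :=
  ∀ α : Form E M 1, α.IsSmooth → α.IsType J 1 → (extD α).proj J 0 = 0

/-- The almost complex structure defined by a `(0,1)`-vector form `φ`, provided that all the maps
`1 + φ_x` are invertible.  Its `(1, 0)`-forms are the forms `α + i_φ α = α ∘ (1 + φ)` with `α` a
`(1, 0)`-form of `M`, that is, `(1 + φ) ∘ J_φ = i (1 + φ)`. -/
def deformedJ (φ : EndField E M) : EndField E M :=
  fun x => Ring.inverse (1 + φ x) * mulI E * (1 + φ x)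

/-- The family of `(0,1)`-vector forms `φ(t)` (given as in `contractAt` by conjugate-linear
endomorphisms of the tangent spaces), smooth in `t ∈ (-ε, ε)` and `x`, defines a
deformation `M_t` of the complex manifold `M`. -/
structure IsDeformation (ε : ℝ) (φ : ℝ → EndField E M) : Prop where
  smooth : IsSmoothEndFamily ε φ
  conj_linear : ∀ t ∈ Set.Ioo (-ε) ε, ∀ x v, φ t x (Complex.I • v) = -(Complex.I • φ t x v)
  zero : ∀ x, φ 0 x = 0
  isUnit : ∀ t ∈ Set.Ioo (-ε) ε, ∀ x, IsUnit (1 + φ t x)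
  integrable : ∀ t ∈ Set.Ioo (-ε) ε, IsIntegrable (deformedJ (φ t))

/-- The derivative `φ'(0)` of a family of `(0,1)`-vector forms. -/
def derivZero (φ : ℝ → EndField E M) : EndField E M :=
  fun x => deriv (fun t => φ t x) 0

end Manifold

end SKT

end

/-! Differentiate the SKT equation at `t = 0`. With `g_t = 1 + φ(t)` one has `J_t = g_t⁻¹ J g_t`, so
the type projection of `M_t` is the fixed projection of `M` conjugated by pullback along `g_t`. The
derivative of pullback at the identity is the derivation `subst φ'(0)`, so the derivative of `π_t^p
η_t` is `π^p η' + subst φ' (π^p η) - π^p (subst φ' η)` (`hasDerivAt_typeProj`).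

Apply this to `π_t^{2,2} d π_t^{1,2} d ω_t = 0`. Since `d∂̄ω = 0`, the outer projection contributes
nothing, and what remains is `π^{2,2} d Z = 0`, where `Z` is the derivative of `π_t^{1,2} d ω_t`.
The real operator `subst φ'` is the sum of `i_φ'`, which sends type `(p,q)` to `(p-1,q+1)`, and its
complex conjugate, which does the opposite. As `ω` is real, `∂̄ω` is conjugate to `∂ω`. With `C =
i_φ' ∂ω` of type `(1,2)` and `D = i_φ' ∂̄ω` of type `(0,3)`, this gives `Z = π^{1,2} dω' + D + conj
C - C`. Taking the `(2,2)`-part of `dZ` kills `D` and leaves `∂∂̄ω' = ∂C - conj (∂C) = 2i Im ∂C`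
(`IsDeformation.del_delbar_formDerivZero`). Only the `(1,1)`-part of `ω'` matters on the left
(`del_delbar_proj`), so `Im ∂C` is `∂∂̄`-exact, and its closedness follows from exactness.

Types are handled through weights: `(p,q)`-forms are those on which the unit circle, acting on
tangent vectors by scalars, acts by `c ^ (p - q)`. Decomposition, conjugation, contraction and `d =
∂ + ∂̄` then become arithmetic of characters. -/

noncomputable section

namespace SKT


/-! ### Types of forms as weights of the circle action -/

section Weights

variable {E : Type*} [NormedAddCommGroup E] [NormedSpace ℂ E] {k : ℕ}

/-- The form obtained by scaling all arguments by `c` is the sum of the type components, each scaled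
by the corresponding character. -/
theorem apply_complex_smul (α : E [⋀^Fin k]→L[ℝ] ℂ) (c : ℂ) (v : Fin k → E) :
    α (fun j => c • v j) = ∑ p ∈ Finset.range (k + 1),
      c ^ p * (starRingEnd ℂ c) ^ (k - p) * typeProj (mulI E) p α v := by
  classical
  -- Both sides are expanded over the sets `T` of slots holding `J v_j`; the coefficients of each
  -- `T` are then compared.
  have hc : (fun j => c • v j) = (fun j => c.im • (mulI E (v j))) + fun j => c.re • v j := by
    funext j
    rw [Pi.add_apply, mulI_apply, ← Complex.coe_smul c.im, ← Complex.coe_smul c.re, smul_smul,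
      ← add_smul]
    congr 1
    conv_lhs => rw [← Complex.re_add_im c]
    ring
  have hl : α (fun j => c • v j) = ∑ T : Finset (Fin k),
      (∏ j, (if j ∈ T then (c.im : ℂ) else c.re)) *
        α (fun j => if j ∈ T then mulI E (v j) else v j) := by
    rw [hc, α.map_add_univ]
    refine Finset.sum_congr rfl fun T _ => ?_
    have : T.piecewise (fun j => c.im • mulI E (v j)) (fun j => c.re • v j) =
        fun j => (if j ∈ T then c.im else c.re) • (if j ∈ T then mulI E (v j) else v j) := by
      funext j
      by_cases h : j ∈ T <;> simp [h]
    rw [this, α.map_smul_univ, ← Complex.coe_smul, smul_eq_mul]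
    push_cast
    congr 1
    exact Finset.prod_congr rfl fun j _ => by split_ifs <;> rfl
  rw [hl]
  have hr : ∀ p ∈ Finset.range (k + 1),
      c ^ p * (starRingEnd ℂ c) ^ (k - p) * typeProj (mulI E) p α v =
      ∑ S ∈ Finset.powersetCard p (Finset.univ : Finset (Fin k)), ∑ T : Finset (Fin k),
        ((∏ j ∈ S, (c / 2 * if j ∈ T then -Complex.I else 1)) *
          ∏ j ∈ Finset.univ \ S, (starRingEnd ℂ c / 2 * if j ∈ T then Complex.I else 1)) *
          α (fun j => if j ∈ T then mulI E (v j) else v j) := by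
    intro p hp
    rw [typeProj_apply, Finset.mul_sum]
    refine Finset.sum_congr rfl fun S hS => ?_
    rw [Finset.mul_sum]
    refine Finset.sum_congr rfl fun T _ => ?_
    have hS' : S.card = p := (Finset.mem_powersetCard.1 hS).2
    have hSc : (Finset.univ \ S).card = k - p := by
      rw [Finset.card_sdiff_of_subset (Finset.subset_univ S), hS',
        Finset.card_univ, Fintype.card_fin]
    have hpk : p + (k - p) = k := by have := Finset.mem_range.1 hp; omega
    have h1 : ∏ j ∈ T, (if j ∈ S then -Complex.I else Complex.I) =
        (∏ j ∈ S, if j ∈ T then -Complex.I else 1) *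
          ∏ j ∈ Finset.univ \ S, if j ∈ T then Complex.I else 1 := by
      have hT : ∏ j ∈ T, (if j ∈ S then -Complex.I else Complex.I) =
          ∏ j, if j ∈ T then (if j ∈ S then -Complex.I else Complex.I) else 1 := by
        rw [Finset.prod_ite_mem, Finset.univ_inter]
      rw [hT, ← Finset.prod_sdiff (Finset.subset_univ S), mul_comm]
      congr 1
      · exact Finset.prod_congr rfl fun j hj => by simp [hj]
      · exact Finset.prod_congr rfl fun j hj => by simp [(Finset.mem_sdiff.1 hj).2]
    rw [h1, Finset.prod_mul_distrib, Finset.prod_mul_distrib, Finset.prod_const, Finset.prod_const,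
      hS', hSc, div_pow, div_pow, div_pow]
    have h2 : (2 : ℂ) ^ k = 2 ^ p * 2 ^ (k - p) := by rw [← pow_add, hpk]
    rw [h2, one_pow]
    field_simp
  rw [Finset.sum_congr rfl hr]
  have hcard := Finset.sum_powerset (Finset.univ : Finset (Fin k)) fun S =>
    ∑ T : Finset (Fin k),
        ((∏ j ∈ S, (c / 2 * if j ∈ T then -Complex.I else 1)) *
          ∏ j ∈ Finset.univ \ S, (starRingEnd ℂ c / 2 * if j ∈ T then Complex.I else 1)) *
          α (fun j => if j ∈ T then mulI E (v j) else v j)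
  rw [Finset.card_univ, Fintype.card_fin] at hcard
  -- For fixed `T` the sum over all `S` factors into a product over slots: `(c/2)(-i) + (c̄/2) i =
  -- im c` on `T`, and `c/2 + c̄/2 = re c` off `T`.
  rw [← hcard, Finset.sum_comm]
  refine Finset.sum_congr rfl fun T _ => ?_
  rw [← Finset.sum_mul, ← Finset.prod_add]
  congr 1
  refine Finset.prod_congr rfl fun j _ => ?_
  have h1 := Complex.re_add_im c
  have h2 : starRingEnd ℂ c = c.re - c.im * Complex.I := by
    apply Complex.ext <;> simp
  rw [h2]
  conv_rhs => rw [← h1]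
  simp only [Complex.add_re, Complex.ofReal_re, Complex.mul_re, Complex.I_re, Complex.I_im,
    Complex.ofReal_im, Complex.add_im, Complex.mul_im]
  split_ifs
  · ring_nf
    rw [Complex.I_sq]
    ring
  · ring_nf

/-- The form `α` has weight `n` under the action of the unit circle by scalar multiplication. -/
def HasWeight (n : ℤ) (α : E [⋀^Fin k]→L[ℝ] ℂ) : Prop :=
  ∀ c : Circle, ∀ v : Fin k → E, α (fun j => (c : ℂ) • v j) = (c : ℂ) ^ n * α v

/-- On the circle `c̄ = c⁻¹`, so `c ^ p * c̄ ^ (k - p)` becomes a single character, with exponent `p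
- q = 2 * p - k`. -/
theorem apply_circle_smul (α : E [⋀^Fin k]→L[ℝ] ℂ) (c : Circle) (v : Fin k → E) :
    α (fun j => (c : ℂ) • v j) = ∑ p ∈ Finset.range (k + 1),
      (c : ℂ) ^ (2 * p - k : ℤ) * typeProj (mulI E) p α v := by
  rw [apply_complex_smul]
  refine Finset.sum_congr rfl fun p hp => ?_
  have hpk : p ≤ k := by have := Finset.mem_range.1 hp; omega
  congr 1
  rw [← Circle.coe_inv_eq_conj, Circle.coe_inv, inv_pow, ← zpow_natCast, ← zpow_natCast, ← zpow_neg,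
    ← zpow_add₀ c.coe_ne_zero]
  congr 1
  push_cast [hpk]
  ring

/-- The character `c ↦ c ^ n` of the circle. -/
def circleChar (n : ℤ) : Circle →* ℂ where
  toFun c := (c : ℂ) ^ n
  map_one' := by simp
  map_mul' a b := by rw [Circle.coe_mul, mul_zpow]

theorem exists_circle_zpow_ne_one {n : ℤ} (hn : n ≠ 0) : ∃ c : Circle, (c : ℂ) ^ n ≠ 1 := by
  -- Its `n`-th power is `exp (iπ) = -1`.
  refine ⟨Circle.exp (Real.pi / n), ?_⟩
  rw [Circle.coe_exp, ← Complex.exp_int_mul]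
  have : (n : ℂ) * (((Real.pi / n : ℝ) : ℂ) * Complex.I) = Real.pi * Complex.I := by
    have : (n : ℂ) ≠ 0 := by exact_mod_cast hn
    push_cast
    field_simp
  rw [this, Complex.exp_pi_mul_I]
  norm_num

theorem circleChar_injective : Function.Injective circleChar := by
  intro m n h
  by_contra hne
  obtain ⟨c, hc⟩ := exists_circle_zpow_ne_one (sub_ne_zero.2 hne)
  apply hc
  have : (c : ℂ) ^ m = (c : ℂ) ^ n := DFunLike.congr_fun h c
  rw [zpow_sub₀ c.coe_ne_zero, this, div_self (zpow_ne_zero _ c.coe_ne_zero)]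

/-- Dedekind's independence of characters: distinct `p` give distinct exponents `2 * p - k`, so a
trigonometric polynomial determines its coefficients. -/
theorem circle_coeff_eq {s : Finset ℕ} {k : ℕ} {a b : ℕ → ℂ}
    (h : ∀ c : Circle, ∑ p ∈ s, (c : ℂ) ^ (2 * p - k : ℤ) * a p =
      ∑ p ∈ s, (c : ℂ) ^ (2 * p - k : ℤ) * b p) {p : ℕ} (hp : p ∈ s) : a p = b p := by
  have hinj : Function.Injective fun p : ℕ => circleChar (2 * p - k : ℤ) := fun p q hpq => by
    have : (2 * p - k : ℤ) = 2 * q - k := circleChar_injective hpq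
    omega
  have hli := (linearIndependent_monoidHom Circle ℂ).comp _ hinj
  rw [linearIndependent_iff'] at hli
  refine sub_eq_zero.1 (hli s (fun p => a p - b p) ?_ p hp)
  funext c
  have := h c
  rw [← sub_eq_zero, ← Finset.sum_sub_distrib] at this
  rw [Finset.sum_apply, Pi.zero_apply, ← this]
  refine Finset.sum_congr rfl fun q _ => ?_
  simp only [Function.comp, Pi.smul_apply, smul_eq_mul, circleChar, MonoidHom.coe_mk, OneHom.coe_mk]
  ring

theorem sum_typeProj (α : E [⋀^Fin k]→L[ℝ] ℂ) :
    ∑ p ∈ Finset.range (k + 1), typeProj (mulI E) p α = α := by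
  ext v
  have := apply_circle_smul α 1 v
  simp only [Circle.coe_one, one_smul, one_zpow, one_mul] at this
  rw [ContinuousAlternatingMap.sum_apply]
  exact this.symm

theorem typeProj_of_lt {J : E →L[ℝ] E} {p : ℕ} (hp : k < p) (α : E [⋀^Fin k]→L[ℝ] ℂ) :
    typeProj J p α = 0 := by
  ext v
  rw [typeProj_apply, Finset.powersetCard_eq_empty.2 (by simpa using hp)]
  simp

/-- Expand `α (d c v)` in `d ∈ Circle` in two ways, as `α ∘ c` evaluated at `d v` and as `α`
evaluated at `(d c) v`, and compare coefficients of the characters of `d`. -/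
theorem hasWeight_typeProj (p : ℕ) (α : E [⋀^Fin k]→L[ℝ] ℂ) :
    HasWeight (2 * p - k) (typeProj (mulI E) p α) := by
  intro c v
  by_cases hp : k < p
  · simp [typeProj_of_lt hp]
  let L : E →L[ℝ] E := ((c : ℂ) • ContinuousLinearMap.id ℂ E).restrictScalars ℝ
  have hL : ∀ v, L v = (c : ℂ) • v := fun v => rfl
  have hcomm : ∀ q, typeProj (mulI E) q (α.compContinuousLinearMap L) v =
      typeProj (mulI E) q α (fun j => (c : ℂ) • v j) := fun q => by
    rw [typeProj_comp _ _ _ _ fun v => by simp [hL, smul_smul, mul_comm]]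
    rfl
  rw [← hcomm]
  refine circle_coeff_eq (s := Finset.range (k + 1)) (k := k)
    (a := fun q => typeProj (mulI E) q (α.compContinuousLinearMap L) v)
    (b := fun q => (c : ℂ) ^ (2 * q - k : ℤ) * typeProj (mulI E) q α v) (fun d => ?_)
    (Finset.mem_range.2 (by omega))
  rw [← apply_circle_smul, ContinuousAlternatingMap.compContinuousLinearMap_apply]
  have h := apply_circle_smul α (d * c) v
  simp only [Circle.coe_mul, mul_zpow] at h
  simp only [← mul_assoc]
  rw [← h]
  refine congrArg α (funext fun j => ?_)
  simp [hL, smul_smul, mul_comm]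

theorem HasWeight.eq_zero_of_ne {m n : ℤ} {α : E [⋀^Fin k]→L[ℝ] ℂ} (hm : HasWeight m α)
    (hn : HasWeight n α) (h : m ≠ n) : α = 0 := by
  obtain ⟨c, hc⟩ := exists_circle_zpow_ne_one (sub_ne_zero.2 h)
  ext v
  have h1 := (hm c v).symm.trans (hn c v)
  by_contra hv
  apply hc
  rw [zpow_sub₀ c.coe_ne_zero, mul_right_cancel₀ hv h1,
    div_self (zpow_ne_zero _ c.coe_ne_zero)]

theorem HasWeight.typeProj {n : ℤ} {α : E [⋀^Fin k]→L[ℝ] ℂ} (h : HasWeight n α) (p : ℕ) :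
    HasWeight n (typeProj (mulI E) p α) := by
  intro c v
  let L : E →L[ℝ] E := ((c : ℂ) • ContinuousLinearMap.id ℂ E).restrictScalars ℝ
  have h1 : α.compContinuousLinearMap L = ((c : ℂ) ^ n) • α := by
    ext v; exact h c v
  have h2 := typeProj_comp (mulI E) p α L fun v => by
    simp [L, smul_smul, mul_comm]
  rw [h1, typeProj_smul] at h2
  exact (congrArg (fun β => β v) h2).symm

theorem HasWeight.typeProj_eq_zero {n : ℤ} {α : E [⋀^Fin k]→L[ℝ] ℂ} (h : HasWeight n α) {p : ℕ}
    (hp : 2 * p - k ≠ n) : SKT.typeProj (mulI E) p α = 0 :=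
  (hasWeight_typeProj p α).eq_zero_of_ne (h.typeProj p) hp

theorem HasWeight.typeProj_eq_self {n : ℤ} {α : E [⋀^Fin k]→L[ℝ] ℂ} (h : HasWeight n α) {p : ℕ}
    (hp : 2 * p - k = n) : SKT.typeProj (mulI E) p α = α := by
  conv_rhs => rw [← sum_typeProj α]
  rw [Finset.sum_eq_single p]
  · intro q _ hq
    exact h.typeProj_eq_zero (by omega)
  · intro hp
    exact typeProj_of_lt (by simpa using hp) α

/-- The dictionary used from here on: bidegree `(p, q)` with `p + q = k` is weight `p - q`. -/
theorem hasWeight_iff {p : ℕ} {α : E [⋀^Fin k]→L[ℝ] ℂ} :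
    HasWeight (2 * p - k) α ↔ typeProj (mulI E) p α = α :=
  ⟨fun h => h.typeProj_eq_self rfl, fun h => h ▸ hasWeight_typeProj p α⟩

/-- The complex conjugate of a complex-valued form. -/
def conjAt (α : E [⋀^Fin k]→L[ℝ] ℂ) : E [⋀^Fin k]→L[ℝ] ℂ :=
  (Complex.conjCLE : ℂ →L[ℝ] ℂ).compContinuousAlternatingMap α

theorem conjAt_apply (α : E [⋀^Fin k]→L[ℝ] ℂ) (v : Fin k → E) :
    conjAt α v = starRingEnd ℂ (α v) := rfl

theorem conjAt_conjAt (α : E [⋀^Fin k]→L[ℝ] ℂ) : conjAt (conjAt α) = α := by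
  ext v; simp [conjAt_apply]

theorem HasWeight.conjAt {n : ℤ} {α : E [⋀^Fin k]→L[ℝ] ℂ} (hα : HasWeight n α) :
    HasWeight (-n) (conjAt α) := fun c v => by
  rw [conjAt_apply, hα c v, map_mul, map_zpow₀, ← Circle.coe_inv_eq_conj, Circle.coe_inv,
    inv_zpow, zpow_neg, conjAt_apply]

theorem conjAt_sum {ι : Type*} (s : Finset ι) (α : ι → E [⋀^Fin k]→L[ℝ] ℂ) :
    conjAt (∑ i ∈ s, α i) = ∑ i ∈ s, conjAt (α i) := by
  ext v; simp [conjAt_apply]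

theorem typeProj_sum (J : E →L[ℝ] E) (p : ℕ) {ι : Type*} (s : Finset ι)
    (α : ι → E [⋀^Fin k]→L[ℝ] ℂ) :
    typeProj J p (∑ i ∈ s, α i) = ∑ i ∈ s, typeProj J p (α i) := by
  classical
  induction s using Finset.induction_on with
  | empty => simp [typeProj_zero]
  | insert a s ha ih => rw [Finset.sum_insert ha, typeProj_add, ih, Finset.sum_insert ha]

/-- Conjugation negates weights, hence exchanges `(p, q)` and `(q, p)`. -/
theorem typeProj_conjAt {p q : ℕ} (h : p + q = k) (α : E [⋀^Fin k]→L[ℝ] ℂ) :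
    typeProj (mulI E) p (conjAt α) = conjAt (typeProj (mulI E) q α) := by
  conv_lhs => rw [← sum_typeProj α, conjAt_sum, typeProj_sum]
  rw [Finset.sum_eq_single q]
  · exact (hasWeight_typeProj q α).conjAt.typeProj_eq_self (by omega)
  · intro r _ hr
    exact (hasWeight_typeProj r α).conjAt.typeProj_eq_zero (by omega)
  · intro hq
    exact absurd (Finset.mem_range.2 (by omega)) hq

theorem contractAt_apply (φ : E →L[ℝ] E) (α : E [⋀^Fin k]→L[ℝ] ℂ) (v : Fin k → E) :
    contractAt φ α v = ∑ l, (1 / 2 : ℂ) * (α (Function.update v l (φ (v l))) -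
      Complex.I * α (Function.update v l (Complex.I • φ (v l)))) := by
  simp only [contractAt, ContinuousAlternatingMap.smul_apply, ContinuousAlternatingMap.sub_apply,
    subst_apply, smul_eq_mul, ← Finset.mul_sum, Finset.sum_sub_distrib]
  rfl

theorem update_complex_smul (α : E [⋀^Fin k]→L[ℝ] ℂ) (v : Fin k → E) (l : Fin k) (c : ℂ) (w : E) :
    α (Function.update v l (c • w)) = c.re * α (Function.update v l w) +
      c.im * α (Function.update v l (Complex.I • w)) := by
  have : c • w = c.re • w + c.im • (Complex.I • w) := by
    rw [← Complex.coe_smul c.im, ← Complex.coe_smul c.re, smul_smul, ← add_smul, Complex.re_add_im]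
  rw [this, α.map_update_add, α.map_update_smul, α.map_update_smul, ← Complex.coe_smul,
    ← Complex.coe_smul, smul_eq_mul, smul_eq_mul]

/-- The `(1, 0)`-part of a form in one of its arguments is complex linear. -/
theorem linearPart_smul (α : E [⋀^Fin k]→L[ℝ] ℂ) (v : Fin k → E) (l : Fin k) (c : ℂ) (w : E) :
    α (Function.update v l (c • w)) - Complex.I * α (Function.update v l (Complex.I • (c • w))) =
      c * (α (Function.update v l w) - Complex.I * α (Function.update v l (Complex.I • w))) := by
  rw [smul_smul, update_complex_smul α v l c, update_complex_smul α v l (Complex.I * c)]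
  conv_rhs => rw [← Complex.re_add_im c]
  simp only [Complex.mul_re, Complex.mul_im, Complex.I_re, Complex.I_im]
  push_cast
  ring_nf
  rw [Complex.I_sq]
  ring

theorem conjLinear_smul {φ : E →L[ℝ] E} (hφ : ∀ v, φ (Complex.I • v) = -(Complex.I • φ v)) (c : ℂ)
    (v : E) : φ (c • v) = starRingEnd ℂ c • φ v := by
  have h1 : c • v = c.re • v + c.im • (Complex.I • v) := by
    rw [← Complex.coe_smul c.im, ← Complex.coe_smul c.re, smul_smul, ← add_smul, Complex.re_add_im]
  have h2 : starRingEnd ℂ c = c.re - c.im * Complex.I := by apply Complex.ext <;> simp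
  rw [h1, map_add, map_smul, map_smul, hφ, h2, sub_smul, mul_smul, Complex.coe_smul,
    Complex.coe_smul, smul_neg, sub_eq_add_neg]

/-- In the contracted slot the conjugate-linear `φ` turns `c` into `c⁻¹ = c⁻² c`. The contraction
sees only the complex linear part of `α` in that slot, so the factor `c⁻²` comes out. -/
theorem HasWeight.contractAt {n : ℤ} {α : E [⋀^Fin k]→L[ℝ] ℂ} (hα : HasWeight n α)
    {φ : E →L[ℝ] E} (hφ : ∀ v, φ (Complex.I • v) = -(Complex.I • φ v)) :
    HasWeight (n - 2) (contractAt φ α) := by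
  intro c v
  rw [contractAt_apply, contractAt_apply, Finset.mul_sum]
  refine Finset.sum_congr rfl fun l _ => ?_
  have hc : (c : ℂ) ≠ 0 := c.coe_ne_zero
  have key : ∀ w, α (Function.update (fun j => (c : ℂ) • v j) l ((c : ℂ) • w)) =
      (c : ℂ) ^ n * α (Function.update v l w) := fun w => by
    rw [← hα c]
    refine congrArg α (funext fun j => ?_)
    by_cases h : j = l
    · subst h; simp
    · simp [h]
  have h1 : φ ((c : ℂ) • v l) = ((c : ℂ)⁻¹ * (c : ℂ)⁻¹) • ((c : ℂ) • φ (v l)) := by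
    rw [conjLinear_smul hφ, ← Circle.coe_inv_eq_conj, Circle.coe_inv, smul_smul]
    congr 1
    field_simp
  rw [h1, linearPart_smul, smul_comm Complex.I, key, key, zpow_sub₀ hc]
  field_simp

/-- The two terms are the complex linear and conjugate-linear parts of `α` in the substituted slot.
For conjugate-linear `φ` this splits the real derivation into pieces shifting the weight by `-2` and
`+2`. -/
theorem subst_eq (φ : E →L[ℝ] E) (α : E [⋀^Fin k]→L[ℝ] ℂ) :
    subst φ α = contractAt φ α + conjAt (contractAt φ (conjAt α)) := by
  ext v
  rw [ContinuousAlternatingMap.add_apply, conjAt_apply, contractAt_apply, contractAt_apply, map_sum,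
    ← Finset.sum_add_distrib, subst_apply]
  refine Finset.sum_congr rfl fun l _ => ?_
  simp only [conjAt_apply, map_mul, map_sub, Complex.conj_conj, Complex.conj_I, map_div₀, map_one,
    map_ofNat]
  ring

/-- The alternatization of a linear map into forms of weight `n` is the sum of a form of weight
`n + 1` and a form of weight `n - 1`. -/
theorem exists_hasWeight_alternatizeUncurryFin {n : ℤ} (A : E →L[ℝ] E [⋀^Fin k]→L[ℝ] ℂ)
    (hA : ∀ v, HasWeight n (A v)) : ∃ β γ : E [⋀^Fin (k + 1)]→L[ℝ] ℂ,
      ContinuousAlternatingMap.alternatizeUncurryFin A = β + γ ∧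
        HasWeight (n + 1) β ∧ HasWeight (n - 1) γ := by
  -- One computation serves both halves of `A`: `s = -1` gives the complex linear part, whose new
  -- argument contributes `c`, and `s = 1` the conjugate-linear part, contributing `c⁻¹`.
  have aux : ∀ (s : ℂ) (m : ℤ), (∀ c : Circle, (c : ℂ).re - s * (c : ℂ).im * Complex.I =
      (c : ℂ) ^ m) → s * s = 1 →
      HasWeight (n + m) (ContinuousAlternatingMap.alternatizeUncurryFin
        ((1 / 2 : ℂ) • (A + (s * Complex.I) • (A ∘L mulI E)))) := by
    intro s m hs hss c v
    rw [ContinuousAlternatingMap.alternatizeUncurryFin_apply,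
      ContinuousAlternatingMap.alternatizeUncurryFin_apply, Finset.mul_sum]
    refine Finset.sum_congr rfl fun i _ => ?_
    have h0 : (i.removeNth fun j => (c : ℂ) • v j) = fun j => (c : ℂ) • i.removeNth v j := rfl
    have h1 : ∀ w, A ((c : ℂ) • w) = (c : ℂ).re • A w + (c : ℂ).im • A (Complex.I • w) := by
      intro w
      rw [← map_smul, ← map_smul, ← map_add, ← Complex.coe_smul, ← Complex.coe_smul, smul_smul,
        ← add_smul, Complex.re_add_im]
    have h2 : Complex.I • (c : ℂ) • v i = (c : ℂ) • Complex.I • v i := smul_comm _ _ _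
    have h3 : A (Complex.I • Complex.I • v i) = - A (v i) := by
      rw [smul_smul, Complex.I_mul_I, neg_one_smul, map_neg]
    simp only [smul_apply, add_apply, ContinuousLinearMap.comp_apply, mulI_apply, h0, h2, h1, h3,
      ContinuousAlternatingMap.smul_apply, ContinuousAlternatingMap.add_apply,
      ContinuousAlternatingMap.neg_apply, smul_neg, Complex.real_smul,
      (hA _) c _, smul_eq_mul, zpow_add₀ c.coe_ne_zero, ← hs c, zsmul_eq_mul]
    have hI := Complex.I_mul_I
    push_cast
    linear_combination ((-1) ^ (i : ℕ) * (c : ℂ) ^ n * (1 / 2) * (c : ℂ).im *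
      (A (Complex.I • v i) (i.removeNth v))) *
        (s * s * hI - hss)
  have hc : ∀ c : Circle, starRingEnd ℂ (c : ℂ) = (c : ℂ).re - (c : ℂ).im * Complex.I := fun c => by
    apply Complex.ext <;> simp
  refine ⟨_, _, ?_, aux (-1) 1 (fun c => ?_) (by norm_num), aux 1 (-1) (fun c => ?_) (by norm_num)⟩
  · rw [← ContinuousAlternatingMap.alternatizeUncurryFin_add]
    congr 1
    ext w v
    simp only [smul_apply, add_apply, ContinuousLinearMap.comp_apply,
      ContinuousAlternatingMap.smul_apply, ContinuousAlternatingMap.add_apply, smul_eq_mul]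
    ring
  · conv_rhs => rw [zpow_one, ← Complex.re_add_im (c : ℂ)]
    ring
  · rw [zpow_neg_one, ← Circle.coe_inv, Circle.coe_inv_eq_conj, hc]
    ring

end Weights


/-! ### Types and conjugation for fields of forms -/

section Pointwise

variable {E : Type*} [NormedAddCommGroup E] [NormedSpace ℂ E] {M : Type*} {k : ℕ}

/-- The complex conjugate of a form. -/
def Form.conj (α : Form E M k) : Form E M k := fun x => conjAt (α x)

theorem Form.proj_add (J : EndField E M) (p : ℕ) (α β : Form E M k) :
    (α + β).proj J p = α.proj J p + β.proj J p := funext fun x => typeProj_add (J x) p _ _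

theorem Form.proj_zero (J : EndField E M) (p : ℕ) : (0 : Form E M k).proj J p = 0 :=
  funext fun x => typeProj_zero (J x) p

theorem Form.isType_proj (p : ℕ) (α : Form E M k) : (α.proj (stdJ E M) p).IsType (stdJ E M) p :=
  funext fun x => hasWeight_iff.1 (hasWeight_typeProj p (α x))

theorem Form.isType_iff {p : ℕ} {α : Form E M k} :
    α.IsType (stdJ E M) p ↔ ∀ x, HasWeight (2 * p - k) (α x) :=
  ⟨fun h x => hasWeight_iff.2 (congrFun h x), fun h => funext fun x => hasWeight_iff.1 (h x)⟩

theorem Form.IsType.proj_of_ne {p q : ℕ} {α : Form E M k} (h : α.IsType (stdJ E M) p)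
    (hpq : q ≠ p) : α.proj (stdJ E M) q = 0 :=
  funext fun x => (Form.isType_iff.1 h x).typeProj_eq_zero (by omega)

theorem Form.sum_proj (α : Form E M k) :
    ∑ p ∈ Finset.range (k + 1), α.proj (stdJ E M) p = α := by
  funext x
  rw [Finset.sum_apply]
  exact sum_typeProj (α x)

theorem Form.conj_conj (α : Form E M k) : α.conj.conj = α := funext fun x => conjAt_conjAt (α x)

theorem Form.proj_conj {p q : ℕ} (h : p + q = k) (α : Form E M k) :
    α.conj.proj (stdJ E M) p = (α.proj (stdJ E M) q).conj :=
  funext fun x => typeProj_conjAt h (α x)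

theorem Form.im_eq (α : Form E M k) : α.im = (1 / (2 * Complex.I)) • (α - α.conj) := by
  funext x
  ext v
  change ((α x v).im : ℂ) = 1 / (2 * Complex.I) * (α x v - starRingEnd ℂ (α x v))
  rw [Complex.sub_conj]
  push_cast
  field_simp

end Pointwise

/-! ### Dolbeault calculus on a complex manifold -/

section Dolbeault

variable {E : Type*} [NormedAddCommGroup E] [NormedSpace ℂ E]
  {M : Type*} [TopologicalSpace M] [ChartedSpace E M] {k : ℕ}

/-- Conjugation as a continuous linear map. -/
def conjCLM (E : Type*) [NormedAddCommGroup E] [NormedSpace ℂ E] (k : ℕ) :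
    (E [⋀^Fin k]→L[ℝ] ℂ) →L[ℝ] (E [⋀^Fin k]→L[ℝ] ℂ) :=
  ContinuousLinearMap.compContinuousAlternatingMapCLM ℝ E ℂ ℂ (Fin k)
    (Complex.conjCLE : ℂ →L[ℝ] ℂ)

theorem Form.IsSmooth.conj {α : Form E M k} (hα : α.IsSmooth) : α.conj.IsSmooth := fun e he =>
  (conjCLM E k).contDiff.comp_contDiffOn (hα e he)

theorem extD_conj {α : Form E M k} (hα : α.IsSmooth) : extD α.conj = (extD α).conj := by
  funext x
  have hx := (chartAt E x).map_source (mem_chart_source E x)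
  have h : fderiv ℝ (α.conj.inChart (chartAt E x)) (chartAt E x x) = (conjCLM E k) ∘L
      fderiv ℝ (α.inChart (chartAt E x)) (chartAt E x x) :=
    ((conjCLM E k).hasFDerivAt.comp _
      (hα.differentiableAt (chart_mem_atlas E x) hx).hasFDerivAt).fderiv
  ext v
  simp only [extD, extDeriv, h, Form.conj, conjAt_apply,
    ContinuousAlternatingMap.compContinuousLinearMap_apply,
    ContinuousAlternatingMap.alternatizeUncurryFin_apply, map_sum]
  refine Finset.sum_congr rfl fun i _ => ?_
  rw [zsmul_eq_mul, zsmul_eq_mul, map_mul, map_intCast]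
  rfl

theorem extD_sub {α β : Form E M k} (hα : α.IsSmooth) (hβ : β.IsSmooth) :
    extD (α - β) = extD α - extD β := by
  have h : α - β = α + (-1 : ℂ) • β := by rw [neg_one_smul, sub_eq_add_neg]
  rw [h, extD_add hα (hβ.smul _), extD_smul, neg_one_smul, sub_eq_add_neg]

theorem extD_zero : extD (0 : Form E M k) = 0 := by
  simpa only [zero_smul] using extD_smul 0 (0 : Form E M k)

theorem del_zero (p : ℕ) : del (stdJ E M) p (0 : Form E M k) = 0 := by
  rw [del, extD_zero, Form.proj_zero]

theorem isType_del (p : ℕ) (α : Form E M k) :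
    (del (stdJ E M) p α).IsType (stdJ E M) (p + 1) := Form.isType_proj (p + 1) (extD α)

theorem isType_delbar (p : ℕ) (α : Form E M k) :
    (delbar (stdJ E M) p α).IsType (stdJ E M) p := Form.isType_proj p (extD α)

section Charts

variable [IsManifold 𝓘(ℂ, E) ∞ M]

theorem extD_apply (α : Form E M k) (x : M) :
    extD α x = extDeriv (α.inChart (chartAt E x)) (chartAt E x x) := by
  ext v
  rw [extD, chartDeriv_chartAt]
  rfl

theorem extD_extD {α : Form E M k} (hα : α.IsSmooth) : extD (extD α) = 0 := by
  funext x
  have he := chart_mem_atlas E x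
  have hx := (chartAt E x).map_source (mem_chart_source E x)
  have hev : (extD α).inChart (chartAt E x) =ᶠ[nhds (chartAt E x x)]
      extDeriv (α.inChart (chartAt E x)) :=
    Filter.eventuallyEq_of_mem ((chartAt E x).open_target.mem_nhds hx)
      fun y hy => inChart_extD hα he hy
  rw [extD_apply, hev.extDeriv_eq]
  exact extDeriv_extDeriv_apply ((hα _ he).contDiffAt ((chartAt E x).open_target.mem_nhds hx))
    minSmoothness_two_le

theorem chartSymmDeriv_smul {e : OpenPartialHomeomorph M E} (he : e ∈ atlas E M) {y : E}
    (hy : y ∈ e.target) (c : ℂ) (v : E) :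
    chartSymmDeriv e y (c • v) = c • chartSymmDeriv e y v := by
  have h : ∀ w : E, c • w = c.re • w + c.im • mulI E w := fun w => by
    rw [mulI_apply, ← Complex.coe_smul c.im, ← Complex.coe_smul c.re, smul_smul, ← add_smul,
      Complex.re_add_im]
  rw [h, h, map_add, map_smul, map_smul, chartSymmDeriv_mulI he hy]

/-- Charts are holomorphic, so their derivatives commute with the circle action. -/
theorem HasWeight.inChart {n : ℤ} {α : Form E M k} (h : ∀ x, HasWeight n (α x))
    {e : OpenPartialHomeomorph M E} (he : e ∈ atlas E M) {y : E} (hy : y ∈ e.target) :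
    HasWeight n (α.inChart e y) := by
  intro c v
  have := h (e.symm y) c fun j => chartSymmDeriv e y (v j)
  simp only [← chartSymmDeriv_smul he hy] at this
  exact this

/-- Having weight `n` is a linear condition with constant coefficients in a chart, so it passes to
the directional derivatives of `α`; alternation then adds one argument, of weight `1` or `-1`. -/
theorem exists_hasWeight_extD {n : ℤ} {α : Form E M k} (hα : α.IsSmooth)
    (h : ∀ x, HasWeight n (α x)) (x : M) : ∃ β γ : E [⋀^Fin (k + 1)]→L[ℝ] ℂ,
      extD α x = β + γ ∧ HasWeight (n + 1) β ∧ HasWeight (n - 1) γ := by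
  have he := chart_mem_atlas E x
  have hx := (chartAt E x).map_source (mem_chart_source E x)
  rw [extD_apply, extDeriv]
  refine exists_hasWeight_alternatizeUncurryFin _ fun w c v => ?_
  -- The vanishing of `L` is the weight condition for these `c` and `v`. As `L` vanishes along `α`
  -- throughout the chart, it vanishes on the derivative of `α`.
  let L : (E [⋀^Fin k]→L[ℝ] ℂ) →L[ℝ] ℂ :=
    ContinuousAlternatingMap.apply ℝ E ℂ (fun j => (c : ℂ) • v j) -
      (c : ℂ) ^ n • ContinuousAlternatingMap.apply ℝ E ℂ v
  have hL : ∀ β, L β = β (fun j => (c : ℂ) • v j) - (c : ℂ) ^ n * β v := fun β => rfl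
  have h0 : (fun y => L (α.inChart (chartAt E x) y)) =ᶠ[nhds (chartAt E x x)] fun _ => 0 :=
    Filter.eventuallyEq_of_mem ((chartAt E x).open_target.mem_nhds hx) fun y hy => by
      simp only [hL]
      rw [HasWeight.inChart h he hy c v, sub_self]
  have h1 : HasFDerivAt (fun y => L (α.inChart (chartAt E x) y))
      (L ∘L fderiv ℝ (α.inChart (chartAt E x)) (chartAt E x x)) (chartAt E x x) :=
    L.hasFDerivAt.comp _ (hα.differentiableAt he hx).hasFDerivAt
  have h2 := h1.unique
    ((hasFDerivAt_const (𝕜 := ℝ) (0 : ℂ) (chartAt E x x)).congr_of_eventuallyEq h0)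
  exact sub_eq_zero.1 (DFunLike.congr_fun h2 w)

theorem Form.IsType.proj_extD {p q : ℕ} {α : Form E M k} (h : α.IsType (stdJ E M) p)
    (hα : α.IsSmooth) (h1 : q ≠ p) (h2 : q ≠ p + 1) : (extD α).proj (stdJ E M) q = 0 := by
  funext x
  obtain ⟨β, γ, h0, hβ, hγ⟩ := exists_hasWeight_extD hα (Form.isType_iff.1 h) x
  change typeProj (mulI E) q (extD α x) = 0
  rw [h0, typeProj_add, hβ.typeProj_eq_zero (by push_cast; omega),
    hγ.typeProj_eq_zero (by push_cast; omega), add_zero]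

theorem Form.IsType.extD_eq {p : ℕ} {α : Form E M k} (h : α.IsType (stdJ E M) p)
    (hα : α.IsSmooth) : extD α = del (stdJ E M) p α + delbar (stdJ E M) p α := by
  funext x
  obtain ⟨β, γ, h0, hβ, hγ⟩ := exists_hasWeight_extD hα (Form.isType_iff.1 h) x
  change extD α x = typeProj (mulI E) (p + 1) (extD α x) + typeProj (mulI E) p (extD α x)
  rw [h0, typeProj_add, typeProj_add, hβ.typeProj_eq_self (by push_cast; ring),
    hγ.typeProj_eq_zero (by push_cast; omega), hβ.typeProj_eq_zero (by push_cast; omega),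
    hγ.typeProj_eq_self (by push_cast; ring), add_zero, zero_add]

theorem Form.IsSmooth.del {α : Form E M k} (hα : α.IsSmooth) (p : ℕ) :
    (del (stdJ E M) p α).IsSmooth := hα.extD.proj (p + 1)

theorem Form.IsSmooth.delbar {α : Form E M k} (hα : α.IsSmooth) (p : ℕ) :
    (delbar (stdJ E M) p α).IsSmooth := hα.extD.proj p

/-- This is `d² = 0`. Its components of types `(p+2,q)`, `(p,q+2)` and `(p+1,q+1)` are the next
three identities. -/
theorem extD_del_add_extD_delbar {p : ℕ} {α : Form E M k} (h : α.IsType (stdJ E M) p)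
    (hα : α.IsSmooth) :
    extD (del (stdJ E M) p α) + extD (delbar (stdJ E M) p α) = 0 := by
  rw [← extD_add (hα.del p) (hα.delbar p), ← h.extD_eq hα, extD_extD hα]

theorem del_del {p : ℕ} {α : Form E M k} (h : α.IsType (stdJ E M) p) (hα : α.IsSmooth) :
    del (stdJ E M) (p + 1) (del (stdJ E M) p α) = 0 := by
  have h1 := congrArg (Form.proj (stdJ E M) (p + 1 + 1)) (extD_del_add_extD_delbar h hα)
  rwa [Form.proj_add, Form.proj_zero, (isType_delbar p α).proj_extD (hα.delbar p)
    (by omega) (by omega),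
    add_zero] at h1

theorem delbar_delbar {p : ℕ} {α : Form E M k} (h : α.IsType (stdJ E M) p) (hα : α.IsSmooth) :
    delbar (stdJ E M) p (delbar (stdJ E M) p α) = 0 := by
  have h1 := congrArg (Form.proj (stdJ E M) p) (extD_del_add_extD_delbar h hα)
  rwa [Form.proj_add, Form.proj_zero, (isType_del p α).proj_extD (hα.del p) (by omega) (by omega),
    zero_add] at h1

theorem delbar_del {p : ℕ} {α : Form E M k} (h : α.IsType (stdJ E M) p) (hα : α.IsSmooth) :
    delbar (stdJ E M) (p + 1) (del (stdJ E M) p α) =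
      -del (stdJ E M) p (delbar (stdJ E M) p α) := by
  have h1 := congrArg (Form.proj (stdJ E M) (p + 1)) (extD_del_add_extD_delbar h hα)
  rw [Form.proj_add, Form.proj_zero] at h1
  exact eq_neg_of_add_eq_zero_left h1

/-- The form `∂∂̄ψ` is `∂`-closed and `∂̄`-closed. -/
theorem del_delbar_mem_bcClosed {p : ℕ} {ψ : Form E M k} (hψ : ψ ∈ formsOfType E M k p) :
    del (stdJ E M) p (delbar (stdJ E M) p ψ) ∈ bcClosed E M (k + 1 + 1) (p + 1) := by
  have hsm := (hψ.1.delbar p).del p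
  have hty := isType_delbar p ψ
  refine ⟨⟨hsm, isType_del p _⟩, del_del hty (hψ.1.delbar p), ?_⟩
  rw [delbar_del hty (hψ.1.delbar p), delbar_delbar hψ.2 hψ.1, del_zero, neg_zero]

end Charts

end Dolbeault


/-! ### Smooth dependence and derivatives of the pointwise operations -/

section Smoothness

variable {E : Type*} [NormedAddCommGroup E] [NormedSpace ℂ E] {k : ℕ}

/-- An alternating form is determined by finitely many values on basis vectors, and a linear left
inverse on that finite-dimensional space of values is automatically continuous. It reduces
smoothness of alternating forms to that of the underlying multilinear maps. -/
theorem exists_leftInverse_toContinuousMultilinearMap [FiniteDimensional ℂ E] :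
    ∃ R : ContinuousMultilinearMap ℝ (fun _ : Fin k => E) ℂ →L[ℝ] E [⋀^Fin k]→L[ℝ] ℂ,
      ∀ α, R α.toContinuousMultilinearMap = α := by
  have : FiniteDimensional ℝ E := FiniteDimensional.complexToReal E
  let b := Module.finBasis ℝ E
  let ev : ContinuousMultilinearMap ℝ (fun _ : Fin k => E) ℂ →L[ℝ]
      ((Fin k → Fin (Module.finrank ℝ E)) → ℂ) :=
    ContinuousLinearMap.pi fun i => ContinuousMultilinearMap.apply ℝ (fun _ : Fin k => E) ℂ
      fun j => b (i j)
  let T : (E [⋀^Fin k]→L[ℝ] ℂ) →L[ℝ] ContinuousMultilinearMap ℝ (fun _ : Fin k => E) ℂ :=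
    ContinuousAlternatingMap.toContinuousMultilinearMapCLM ℝ
  have hinj : LinearMap.ker (ev ∘L T).toLinearMap = ⊥ := by
    rw [LinearMap.ker_eq_bot']
    intro α hα
    have h : α.toMultilinearMap = 0 :=
      Module.Basis.ext_multilinear (fun _ => b) fun v => congrFun hα v
    ext v
    exact congrArg (fun f => f v) h
  obtain ⟨L, hL⟩ := LinearMap.exists_leftInverse_of_injective _ hinj
  exact ⟨LinearMap.toContinuousLinearMap L ∘L ev, fun α => LinearMap.congr_fun hL α⟩

theorem contDiff_alternating {V : Type*} [NormedAddCommGroup V] [NormedSpace ℝ V]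
    [FiniteDimensional ℂ E] {n : WithTop ℕ∞} {f : V → E [⋀^Fin k]→L[ℝ] ℂ}
    (hf : ContDiff ℝ n fun z => (f z).toContinuousMultilinearMap) : ContDiff ℝ n f := by
  obtain ⟨R, hR⟩ := exists_leftInverse_toContinuousMultilinearMap (E := E) (k := k)
  have : f = fun z => R (f z).toContinuousMultilinearMap := funext fun z => (hR _).symm
  rw [this]
  exact R.contDiff.comp hf

theorem contDiff_multilinear_comp {V : Type*} [NormedAddCommGroup V] [NormedSpace ℝ V]
    {n : WithTop ℕ∞} {α : V → E [⋀^Fin k]→L[ℝ] ℂ} {A : V → Fin k → E →L[ℝ] E}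
    (hα : ContDiff ℝ n α) (hA : ContDiff ℝ n A) :
    ContDiff ℝ n fun z =>
      (α z).toContinuousMultilinearMap.compContinuousLinearMap (A z) := by
  have h1 : ContDiff ℝ n fun z =>
      ContinuousMultilinearMap.compContinuousLinearMapContinuousMultilinear ℝ
        (fun _ : Fin k => E) (fun _ : Fin k => E) ℂ (A z) :=
    (ContinuousMultilinearMap.contDiff _).comp hA
  have h2 : ContDiff ℝ n fun z => (α z).toContinuousMultilinearMap :=
    (ContinuousAlternatingMap.toContinuousMultilinearMapCLM (𝕜 := ℝ) (E := E) (F := ℂ)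
      (ι := Fin k) ℝ).contDiff.comp hα
  exact h1.clm_apply h2

theorem contDiff_compContinuousLinearMap [FiniteDimensional ℂ E] {n : WithTop ℕ∞} :
    ContDiff ℝ n fun z : (E [⋀^Fin k]→L[ℝ] ℂ) × (E →L[ℝ] E) =>
      z.1.compContinuousLinearMap z.2 :=
  contDiff_alternating
    (contDiff_multilinear_comp contDiff_fst (contDiff_pi.2 fun _ => contDiff_snd))

theorem contDiff_subst [FiniteDimensional ℂ E] {n : WithTop ℕ∞} :
    ContDiff ℝ n fun z : (E [⋀^Fin k]→L[ℝ] ℂ) × (E →L[ℝ] E) => subst z.2 z.1 := by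
  refine contDiff_alternating (?_ : ContDiff ℝ n fun z : (E [⋀^Fin k]→L[ℝ] ℂ) × (E →L[ℝ] E) =>
    ∑ l : Fin k, z.1.toContinuousMultilinearMap.compContinuousLinearMap
      fun j => if j = l then z.2 else ContinuousLinearMap.id ℝ E)
  refine ContDiff.sum fun l _ => ?_
  refine contDiff_multilinear_comp contDiff_fst (contDiff_pi.2 fun j => ?_)
  by_cases h : j = l
  · simpa [h] using contDiff_snd
  · simpa [h] using contDiff_const

theorem contDiff_contractAt [FiniteDimensional ℂ E] {n : WithTop ℕ∞} :
    ContDiff ℝ n fun z : (E [⋀^Fin k]→L[ℝ] ℂ) × (E →L[ℝ] E) => contractAt z.2 z.1 := by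
  refine ContDiff.const_smul _ (contDiff_subst.sub (ContDiff.const_smul _ ?_))
  exact contDiff_subst.comp (contDiff_fst.prodMk (contDiff_const.clm_comp contDiff_snd))

theorem subst_comp {A B L : E →L[ℝ] E} (h : ∀ v, A (L v) = L (B v)) (α : E [⋀^Fin k]→L[ℝ] ℂ) :
    (subst A α).compContinuousLinearMap L = subst B (α.compContinuousLinearMap L) := by
  ext v
  simp only [subst_apply, ContinuousAlternatingMap.compContinuousLinearMap_apply]
  refine Finset.sum_congr rfl fun l _ => congrArg α (funext fun j => ?_)
  by_cases hj : j = l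
  · subst hj; simp [h]
  · simp [hj]

theorem contractAt_comp {A B L : E →L[ℝ] E} (h : ∀ v, A (L v) = L (B v))
    (hL : ∀ v, L (mulI E v) = mulI E (L v)) (α : E [⋀^Fin k]→L[ℝ] ℂ) :
    (contractAt A α).compContinuousLinearMap L = contractAt B (α.compContinuousLinearMap L) := by
  have h' : ∀ v, (mulI E ∘L A) (L v) = L ((mulI E ∘L B) v) := fun v => by
    rw [ContinuousLinearMap.comp_apply, ContinuousLinearMap.comp_apply, h, hL]
  rw [contractAt, contractAt, ← subst_comp h, ← subst_comp h']
  rfl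

theorem typeProj_comp_of_intertwine {J J' L : E →L[ℝ] E} (p : ℕ) (α : E [⋀^Fin k]→L[ℝ] ℂ)
    (h : ∀ v, L (J' v) = J (L v)) :
    typeProj J' p (α.compContinuousLinearMap L) = (typeProj J p α).compContinuousLinearMap L := by
  ext v
  simp only [typeProj_apply, ContinuousAlternatingMap.compContinuousLinearMap_apply]
  refine Finset.sum_congr rfl fun S _ => Finset.sum_congr rfl fun T _ => ?_
  congr 1
  refine congrArg α (funext fun j => ?_)
  simp only [Function.comp]
  split_ifs <;> simp [h]

/-- Pullback by `g`, an isomorphism from `(E, g⁻¹ J g)` to `(E, J)`, preserves types. A moving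
projection thus becomes a fixed one between two pullbacks, which carry all the dependence on `t`. -/
theorem typeProj_conjugate {g : E →L[ℝ] E} (hg : IsUnit g) (J : E →L[ℝ] E) (p : ℕ)
    (α : E [⋀^Fin k]→L[ℝ] ℂ) :
    typeProj (Ring.inverse g * J * g) p α =
      (typeProj J p (α.compContinuousLinearMap (Ring.inverse g))).compContinuousLinearMap g := by
  rw [← typeProj_comp_of_intertwine (J := J) (J' := Ring.inverse g * J * g)]
  · congr 1
    ext v
    refine congrArg α (funext fun j => ?_)
    exact (DFunLike.congr_fun (Ring.inverse_mul_cancel g hg) (v j)).symm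
  · intro v
    change (g * (Ring.inverse g * J * g)) v = _
    rw [← mul_assoc, ← mul_assoc, Ring.mul_inverse_cancel g hg, one_mul]
    rfl

/-- `typeProj J p` as a continuous linear map. -/
def typeProjCLM (J : E →L[ℝ] E) (p : ℕ) : (E [⋀^Fin k]→L[ℝ] ℂ) →L[ℝ] (E [⋀^Fin k]→L[ℝ] ℂ) where
  toFun := typeProj J p
  map_add' := typeProj_add J p
  map_smul' c α := by
    ext v
    simp only [typeProj_apply, ContinuousAlternatingMap.smul_apply, RingHom.id_apply,
      Finset.smul_sum, mul_smul_comm]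
  cont := (contDiff_typeProj J p).continuous

theorem typeProjCLM_apply (J : E →L[ℝ] E) (p : ℕ) (α : E [⋀^Fin k]→L[ℝ] ℂ) :
    typeProjCLM J p α = typeProj J p α := rfl

/-- The Leibniz rule: at `g = 1`, varying one copy of `g` at a time gives `subst g'`. -/
theorem hasDerivAt_compContinuousLinearMap {β : ℝ → E [⋀^Fin k]→L[ℝ] ℂ}
    {β' : E [⋀^Fin k]→L[ℝ] ℂ} {g : ℝ → E →L[ℝ] E} {g' : E →L[ℝ] E} (hβ : HasDerivAt β β' 0)
    (hg : HasDerivAt g g' 0) (hg0 : g 0 = 1) :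
    HasDerivAt (fun t => (β t).compContinuousLinearMap (g t)) (β' + subst g' (β 0)) 0 := by
  have h := (ContinuousAlternatingMap.hasStrictFDerivAt_compContinuousLinearMap
    (β 0, g 0)).hasFDerivAt.comp_hasDerivAt (0 : ℝ) (hβ.prodMk hg)
  refine h.congr_deriv ?_
  ext v
  simp only [add_apply, ContinuousLinearMap.comp_apply, ContinuousLinearMap.coe_fst',
    ContinuousLinearMap.coe_snd', ContinuousAlternatingMap.add_apply, hg0, subst_apply,
    ContinuousAlternatingMap.fderivCompContinuousLinearMap_apply]
  congr 1
  refine Finset.sum_congr rfl fun l _ => congrArg (β 0) (funext fun j => ?_)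
  by_cases hj : j = l
  · subst hj; simp
  · simp [hj]

theorem subst_neg (A : E →L[ℝ] E) (α : E [⋀^Fin k]→L[ℝ] ℂ) : subst (-A) α = -subst A α := by
  ext v
  simp only [subst_apply, ContinuousAlternatingMap.neg_apply, ← Finset.sum_neg_distrib]
  refine Finset.sum_congr rfl fun l _ => ?_
  have := α.map_update_smul v l (-1 : ℝ) (A (v l))
  simpa using this

theorem subst_zero (A : E →L[ℝ] E) : subst A (0 : E [⋀^Fin k]→L[ℝ] ℂ) = 0 := by
  ext v
  simp [subst_apply]

/-- The derivative of the type projection along a deformation of the complex structure. -/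
theorem hasDerivAt_typeProj [FiniteDimensional ℂ E] (J : E →L[ℝ] E) (p : ℕ)
    {η : ℝ → E [⋀^Fin k]→L[ℝ] ℂ}
    {η' : E [⋀^Fin k]→L[ℝ] ℂ} {ψ : ℝ → E →L[ℝ] E} {ψ' : E →L[ℝ] E} (hη : HasDerivAt η η' 0)
    (hψ : HasDerivAt ψ ψ' 0) (hψ0 : ψ 0 = 0) (hu : ∀ᶠ t in nhds 0, IsUnit (1 + ψ t)) :
    HasDerivAt (fun t => typeProj (Ring.inverse (1 + ψ t) * J * (1 + ψ t)) p (η t))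
      (typeProj J p η' + subst ψ' (typeProj J p (η 0)) - typeProj J p (subst ψ' (η 0))) 0 := by
  have : FiniteDimensional ℝ E := FiniteDimensional.complexToReal E
  have : CompleteSpace E := FiniteDimensional.complete ℝ E
  have hg : HasDerivAt (fun t => 1 + ψ t) ψ' 0 := hψ.const_add 1
  have hi : HasDerivAt (fun t => Ring.inverse (1 + ψ t)) (-ψ') 0 := by
    have h1 := hasFDerivAt_ringInverse (𝕜 := ℝ) (1 : (E →L[ℝ] E)ˣ)
    have h2 : ((1 : (E →L[ℝ] E)ˣ) : E →L[ℝ] E) = (fun t => 1 + ψ t) 0 := by simp [hψ0]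
    rw [h2] at h1
    refine (h1.comp_hasDerivAt (0 : ℝ) hg).congr_deriv ?_
    simp
  -- In the conjugated form of the projection, pullback by the inverse yields `-subst ψ'` inside
  -- `typeProj`, and pullback by `1 + ψ` yields `+subst ψ'` outside.
  have h1 := hasDerivAt_compContinuousLinearMap hη hi (by simp [hψ0])
  have h2 := (typeProjCLM J p).hasFDerivAt.comp_hasDerivAt (0 : ℝ) h1
  have h3 := hasDerivAt_compContinuousLinearMap h2 hg (by simp [hψ0])
  refine (h3.congr_of_eventuallyEq ?_).congr_deriv ?_
  · filter_upwards [hu] with t ht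
    exact typeProj_conjugate ht J p (η t)
  · have h4 : (η 0).compContinuousLinearMap (Ring.inverse (1 + ψ 0)) = η 0 := by
      rw [hψ0, add_zero, Ring.inverse_one]; rfl
    simp only [Function.comp, h4, typeProjCLM_apply, typeProj_add, subst_neg]
    have h5 : typeProj J p (-subst ψ' (η 0)) = -typeProj J p (subst ψ' (η 0)) :=
      map_neg (typeProjCLM J p) _
    rw [h5]
    abel

end Smoothness

/-! ### Exchanging the parameter derivative with space derivatives -/

section Parameter

variable {V G : Type*} [NormedAddCommGroup V] [NormedSpace ℝ V] [NormedAddCommGroup G]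
  [NormedSpace ℝ G]

theorem fderiv_slice_right {F : ℝ × V → G} {t : ℝ} {y : V} (h : DifferentiableAt ℝ F (t, y)) :
    fderiv ℝ (fun y => F (t, y)) y = fderiv ℝ F (t, y) ∘L ContinuousLinearMap.inr ℝ ℝ V :=
  (h.hasFDerivAt.comp y (hasFDerivAt_prodMk_right t y)).fderiv

theorem hasDerivAt_slice_left {F : ℝ × V → G} {t : ℝ} {y : V} (h : DifferentiableAt ℝ F (t, y)) :
    HasDerivAt (fun t => F (t, y)) (fderiv ℝ F (t, y) (1, 0)) t := by
  have h1 : HasDerivAt (fun t : ℝ => (t, y)) ((1 : ℝ), (0 : V)) t :=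
    (hasDerivAt_id t).prodMk (hasDerivAt_const t y)
  exact h.hasFDerivAt.comp_hasDerivAt t h1

/-- The derivative in the parameter commutes with the derivative in the space variable. -/
theorem hasDerivAt_fderiv_slice {F : ℝ × V → G} {y : V} (h : ContDiffAt ℝ ∞ F (0, y)) :
    HasDerivAt (fun t => fderiv ℝ (fun y => F (t, y)) y)
      (fderiv ℝ (fun y => deriv (fun t => F (t, y)) 0) y) 0 := by
  have hd : ∀ᶠ z in nhds ((0 : ℝ), y), DifferentiableAt ℝ F z :=
    ((h.of_le (m := 1) (by simp)).eventually (by simp)).mono fun z hz =>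
      hz.differentiableAt (by simp)
  have hF' : DifferentiableAt ℝ (fderiv ℝ F) (0, y) :=
    (h.fderiv_right (m := 1) (by norm_cast)).differentiableAt (by simp)
  have hsymm := (h.isSymmSndFDerivAt minSmoothness_two_le)
  have ht : ∀ᶠ t in nhds (0 : ℝ), DifferentiableAt ℝ F (t, y) :=
    (Continuous.prodMk_left y).continuousAt.eventually hd
  have hy : ∀ᶠ z in nhds y, DifferentiableAt ℝ F (0, z) :=
    (Continuous.prodMk_right (0 : ℝ)).continuousAt.eventually hd
  have h1 : HasDerivAt (fun t => fderiv ℝ F (t, y) ∘L ContinuousLinearMap.inr ℝ ℝ V)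
      (fderiv ℝ (fderiv ℝ F) (0, y) (1, 0) ∘L ContinuousLinearMap.inr ℝ ℝ V) 0 :=
    ((ContinuousLinearMap.compL ℝ V (ℝ × V) G).flip
      (ContinuousLinearMap.inr ℝ ℝ V)).hasFDerivAt.comp_hasDerivAt (0 : ℝ)
        (hasDerivAt_slice_left hF')
  have h2 : HasFDerivAt (fun z => fderiv ℝ F (0, z) (1, 0))
      ((ContinuousLinearMap.apply ℝ G ((1 : ℝ), (0 : V))) ∘L
        (fderiv ℝ (fderiv ℝ F) (0, y) ∘L ContinuousLinearMap.inr ℝ ℝ V)) y :=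
    (ContinuousLinearMap.apply ℝ G ((1 : ℝ), (0 : V))).hasFDerivAt.comp y
      (hF'.hasFDerivAt.comp y (hasFDerivAt_prodMk_right (0 : ℝ) y))
  have h3 : (fun z => deriv (fun t => F (t, z)) 0) =ᶠ[nhds y] fun z => fderiv ℝ F (0, z) (1, 0) :=
    hy.mono fun z hz => (hasDerivAt_slice_left hz).deriv
  rw [h3.fderiv_eq, h2.fderiv]
  refine (h1.congr_of_eventuallyEq (ht.mono fun t => fderiv_slice_right)).congr_deriv ?_
  ext w
  -- The exchange is the symmetry of the second derivative of `F` in the directions of `t` and of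
  -- `w`.
  exact hsymm (1, 0) (0, w)

theorem hasDerivAt_extDeriv {k : ℕ} {F : ℝ × V → V [⋀^Fin k]→L[ℝ] G} {y : V}
    (h : ContDiffAt ℝ ∞ F (0, y)) :
    HasDerivAt (fun t => extDeriv (fun y => F (t, y)) y)
      (extDeriv (fun y => deriv (fun t => F (t, y)) 0) y) 0 := by
  have h1 := (hasDerivAt_fderiv_slice h).hasFDerivAt
  have h2 := (ContinuousAlternatingMap.alternatizeUncurryFinCLM (n := k) ℝ V G).hasFDerivAt
    (x := fderiv ℝ (fun y => F (0, y)) y)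
  exact (h2.comp (0 : ℝ) h1).hasDerivAt.congr_deriv
    (congrArg (ContinuousAlternatingMap.alternatizeUncurryFinCLM ℝ V G) (one_smul ℝ _))

theorem contDiffOn_extDeriv {k : ℕ} {F : ℝ × V → V [⋀^Fin k]→L[ℝ] G} {I : Set ℝ} {U : Set V}
    (hI : IsOpen I) (hU : IsOpen U) (h : ContDiffOn ℝ ∞ F (I ×ˢ U)) :
    ContDiffOn ℝ ∞ (fun z : ℝ × V => extDeriv (fun y => F (z.1, y)) z.2) (I ×ˢ U) := by
  have ho := hI.prod hU
  have h1 : ContDiffOn ℝ ∞ (fderiv ℝ F) (I ×ˢ U) := h.fderiv_of_isOpen ho (by simp)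
  have h2 : ContDiffOn ℝ ∞ (fun z => fderiv ℝ F z ∘L ContinuousLinearMap.inr ℝ ℝ V) (I ×ˢ U) :=
    h1.clm_comp contDiffOn_const
  refine ((ContinuousAlternatingMap.alternatizeUncurryFinCLM ℝ V G).contDiff.comp_contDiffOn
    h2).congr fun z hz => ?_
  have hd : DifferentiableAt ℝ F (z.1, z.2) :=
    (h.contDiffAt (ho.mem_nhds hz)).differentiableAt (by simp)
  exact congrArg _ (fderiv_slice_right hd)

theorem contDiffOn_deriv_zero {F : ℝ × V → G} {I : Set ℝ} {U : Set V}
    (hI : IsOpen I) (h0 : (0 : ℝ) ∈ I) (hU : IsOpen U) (h : ContDiffOn ℝ ∞ F (I ×ˢ U)) :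
    ContDiffOn ℝ ∞ (fun y => deriv (fun t => F (t, y)) 0) U := by
  have ho := hI.prod hU
  have h1 : ContDiffOn ℝ ∞ (fderiv ℝ F) (I ×ˢ U) := h.fderiv_of_isOpen ho (by simp)
  have h2 : ContDiffOn ℝ ∞ (fun y : V => fderiv ℝ F (0, y) (1, 0)) U :=
    (h1.comp (contDiff_prodMk_right (0 : ℝ)).contDiffOn fun y hy => ⟨h0, hy⟩).clm_apply
      contDiffOn_const
  exact h2.congr fun y hy => (hasDerivAt_slice_left
    ((h.contDiffAt (ho.mem_nhds ⟨h0, hy⟩)).differentiableAt (by simp))).deriv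

end Parameter


/-! ### Naturality of the operations in charts -/

section Families

variable {E : Type*} [NormedAddCommGroup E] [NormedSpace ℂ E]
  {M : Type*} [TopologicalSpace M] [ChartedSpace E M] {k : ℕ} [IsManifold 𝓘(ℂ, E) ∞ M]

theorem chartDeriv_comp_chartSymmDeriv_self {e : OpenPartialHomeomorph M E} (he : e ∈ atlas E M)
    {y : E} (hy : y ∈ e.target) :
    chartDeriv e (e.symm y) * chartSymmDeriv e y = 1 := by
  have := isManifold_real E M
  have : IsManifold 𝓘(ℝ, E) 1 M := IsManifold.of_le (n := ∞) (by norm_num)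
  exact (mdifferentiable_of_mem_atlas (I := 𝓘(ℝ, E)) he).comp_symm_deriv hy

theorem chartSymmDeriv_comp_chartDeriv_self {e : OpenPartialHomeomorph M E} (he : e ∈ atlas E M)
    {y : E} (hy : y ∈ e.target) :
    chartSymmDeriv e y * chartDeriv e (e.symm y) = 1 := by
  have := isManifold_real E M
  have : IsManifold 𝓘(ℝ, E) 1 M := IsManifold.of_le (n := ∞) (by norm_num)
  have h : chartSymmDeriv e (e (e.symm y)) * chartDeriv e (e.symm y) = 1 :=
    (mdifferentiable_of_mem_atlas (I := 𝓘(ℝ, E)) he).symm_comp_deriv (e.map_target hy)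
  rwa [e.right_inv hy] at h

theorem chartSymmDeriv_chartAt (x : M) :
    chartSymmDeriv (chartAt E x) (chartAt E x x) = 1 := by
  have h := chartSymmDeriv_comp_chartDeriv_self (chart_mem_atlas E x)
    ((chartAt E x).map_source (mem_chart_source E x))
  rwa [(chartAt E x).left_inv (mem_chart_source E x), chartDeriv_chartAt] at h

theorem Form.inChart_chartAt (α : Form E M k) (x : M) :
    α.inChart (chartAt E x) (chartAt E x x) = α x := by
  rw [Form.inChart, chartSymmDeriv_chartAt, (chartAt E x).left_inv (mem_chart_source E x)]
  rfl

theorem EndField.inChart_chartAt (A : EndField E M) (x : M) :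
    A.inChart (chartAt E x) (chartAt E x x) = A x := by
  rw [EndField.inChart, chartSymmDeriv_chartAt, (chartAt E x).left_inv (mem_chart_source E x),
    chartDeriv_chartAt]
  rfl

/-- The intertwining relation behind the naturality of projection, substitution and contraction. -/
theorem chartSymmDeriv_inChart (A : EndField E M) {e : OpenPartialHomeomorph M E}
    (he : e ∈ atlas E M) {y : E} (hy : y ∈ e.target) (v : E) :
    chartSymmDeriv e y (A.inChart e y v) = A (e.symm y) (chartSymmDeriv e y v) :=
  DFunLike.congr_fun (chartSymmDeriv_comp_chartDeriv_self he hy) _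

theorem Form.inChart_proj (J : EndField E M) (p : ℕ) (α : Form E M k)
    {e : OpenPartialHomeomorph M E} (he : e ∈ atlas E M) {y : E} (hy : y ∈ e.target) :
    (α.proj J p).inChart e y = typeProj (J.inChart e y) p (α.inChart e y) :=
  (typeProj_comp_of_intertwine p _ fun v => chartSymmDeriv_inChart J he hy v).symm

/-- The form `(v_1, …, v_k) ↦ ∑_l α (v_1, …, A v_l, …, v_k)`, for a field `A` of endomorphisms. -/
def substField (A : EndField E M) (α : Form E M k) : Form E M k := fun x => subst (A x) (α x)

theorem inChart_substField (A : EndField E M) (α : Form E M k)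
    {e : OpenPartialHomeomorph M E} (he : e ∈ atlas E M) {y : E} (hy : y ∈ e.target) :
    (substField A α).inChart e y = subst (A.inChart e y) (α.inChart e y) :=
  subst_comp (fun v => (chartSymmDeriv_inChart A he hy v).symm) _

theorem inChart_contract (A : EndField E M) (α : Form E M k)
    {e : OpenPartialHomeomorph M E} (he : e ∈ atlas E M) {y : E} (hy : y ∈ e.target) :
    (contract A α).inChart e y = contractAt (A.inChart e y) (α.inChart e y) :=
  contractAt_comp (fun v => (chartSymmDeriv_inChart A he hy v).symm)
    (fun v => chartSymmDeriv_mulI he hy v) _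

theorem Form.IsSmooth.contract [FiniteDimensional ℂ E] {α : Form E M k} (hα : α.IsSmooth)
    {A : EndField E M} (hA : ∀ e ∈ atlas E M, ContDiffOn ℝ ∞ (A.inChart e) e.target) :
    (contract A α).IsSmooth := fun e he =>
  (contDiff_contractAt.comp_contDiffOn ((hα e he).prodMk (hA e he))).congr fun _ hy =>
    inChart_contract A α he hy

theorem inChart_stdJ {e : OpenPartialHomeomorph M E} (he : e ∈ atlas E M) {y : E}
    (hy : y ∈ e.target) : (stdJ E M).inChart e y = mulI E := by
  ext v
  have h := DFunLike.congr_fun (chartDeriv_comp_chartSymmDeriv_self he hy) (mulI E v)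
  refine Eq.trans ?_ h
  exact congrArg (chartDeriv e (e.symm y)) (chartSymmDeriv_mulI he hy v).symm

theorem one_add_inChart (φ : EndField E M) {e : OpenPartialHomeomorph M E} (he : e ∈ atlas E M)
    {y : E} (hy : y ∈ e.target) : 1 + φ.inChart e y =
      chartDeriv e (e.symm y) * (1 + φ (e.symm y)) * chartSymmDeriv e y := by
  rw [mul_add, add_mul, mul_one, chartDeriv_comp_chartSymmDeriv_self he hy]
  rfl

theorem isUnit_one_add_inChart {φ : EndField E M} (h : ∀ x, IsUnit (1 + φ x))
    {e : OpenPartialHomeomorph M E} (he : e ∈ atlas E M) {y : E} (hy : y ∈ e.target) :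
    IsUnit (1 + φ.inChart e y) := by
  rw [one_add_inChart φ he hy]
  have h1 := chartDeriv_comp_chartSymmDeriv_self he hy
  have h2 := chartSymmDeriv_comp_chartDeriv_self he hy
  exact (IsUnit.mul ⟨⟨_, _, h1, h2⟩, rfl⟩ (h _)).mul ⟨⟨_, _, h2, h1⟩, rfl⟩

/-- Passing to a chart is conjugation by the derivative `w` of the chart, and `w` commutes with
multiplication by `i`; hence only `φ` changes in the formula for the deformed structure. -/
theorem inChart_deformedJ {φ : EndField E M} (h : ∀ x, IsUnit (1 + φ x))
    {e : OpenPartialHomeomorph M E} (he : e ∈ atlas E M) {y : E} (hy : y ∈ e.target) :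
    (deformedJ φ).inChart e y =
      Ring.inverse (1 + φ.inChart e y) * mulI E * (1 + φ.inChart e y) := by
  have h1 := chartDeriv_comp_chartSymmDeriv_self he hy
  have h2 := chartSymmDeriv_comp_chartDeriv_self he hy
  obtain ⟨u, hu⟩ := h (e.symm y)
  let w : (E →L[ℝ] E)ˣ := ⟨_, _, h1, h2⟩
  have hw : 1 + φ.inChart e y = ((w * u * w⁻¹ : (E →L[ℝ] E)ˣ) : E →L[ℝ] E) := by
    rw [one_add_inChart φ he hy, ← hu]
    rfl
  have hJ : (w⁻¹ : (E →L[ℝ] E)ˣ) * mulI E = mulI E * (w⁻¹ : (E →L[ℝ] E)ˣ) := by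
    ext v
    exact chartSymmDeriv_mulI he hy v
  have hd : (deformedJ φ).inChart e y =
      w * (Ring.inverse (u : E →L[ℝ] E) * mulI E * u) * (w⁻¹ : (E →L[ℝ] E)ˣ) := by
    rw [hu]
    rfl
  rw [hd, hw, Ring.inverse_unit, Ring.inverse_unit]
  simp only [mul_inv_rev, inv_inv, Units.val_mul]
  have : (w⁻¹ : (E →L[ℝ] E)ˣ) * (mulI E * (w : E →L[ℝ] E)) = mulI E := by
    rw [← mul_assoc, hJ, mul_assoc, Units.inv_mul, mul_one]
  simp only [mul_assoc]
  rw [← mul_assoc (mulI E) (w : E →L[ℝ] E), ← mul_assoc ((w⁻¹ : (E →L[ℝ] E)ˣ) : E →L[ℝ] E), this]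

end Families


/-! ### First variation of the equation `π_t^q d π_t^p d α_t = 0` -/

section Variation

variable {E : Type*} [NormedAddCommGroup E] [NormedSpace ℂ E]
  {M : Type*} [TopologicalSpace M] [ChartedSpace E M] {k : ℕ} {ε : ℝ}

/-- The derivative at `0` of a family of forms. -/
def formDerivZero (α : ℝ → Form E M k) : Form E M k := fun x => deriv (fun t => α t x) 0

theorem IsSmoothFormFamily.contDiffAt {α : ℝ → Form E M k} (hα : IsSmoothFormFamily ε α)
    {e : OpenPartialHomeomorph M E} (he : e ∈ atlas E M) {t : ℝ} (ht : t ∈ Set.Ioo (-ε) ε) {y : E}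
    (hy : y ∈ e.target) : ContDiffAt ℝ ∞ (fun z : ℝ × E => (α z.1).inChart e z.2) (t, y) :=
  (hα e he).contDiffAt ((isOpen_Ioo.prod e.open_target).mem_nhds ⟨ht, hy⟩)

theorem IsSmoothEndFamily.contDiffAt {A : ℝ → EndField E M} (hA : IsSmoothEndFamily ε A)
    {e : OpenPartialHomeomorph M E} (he : e ∈ atlas E M) {t : ℝ} (ht : t ∈ Set.Ioo (-ε) ε) {y : E}
    (hy : y ∈ e.target) : ContDiffAt ℝ ∞ (fun z : ℝ × E => (A z.1).inChart e z.2) (t, y) :=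
  (hA e he).contDiffAt ((isOpen_Ioo.prod e.open_target).mem_nhds ⟨ht, hy⟩)

theorem IsDeformation.deformedJ_zero {φ : ℝ → EndField E M} (hφ : IsDeformation ε φ) :
    deformedJ (φ 0) = stdJ E M := by
  funext x
  simp [deformedJ, hφ.zero, stdJ]

variable [IsManifold 𝓘(ℂ, E) ∞ M]

theorem IsSmoothFormFamily.hasDerivAt {α : ℝ → Form E M k} (hα : IsSmoothFormFamily ε α)
    (hε : 0 < ε) (x : M) : HasDerivAt (fun t => α t x) (formDerivZero α x) 0 := by
  have h := (hasDerivAt_slice_left ((hα.contDiffAt (chart_mem_atlas E x)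
    (Set.mem_Ioo.2 ⟨neg_lt_zero.2 hε, hε⟩) ((chartAt E x).map_source
      (mem_chart_source E x))).differentiableAt (by simp))).differentiableAt
  simp only [Form.inChart_chartAt] at h
  exact h.hasDerivAt

theorem IsSmoothEndFamily.hasDerivAt {A : ℝ → EndField E M} (hA : IsSmoothEndFamily ε A)
    (hε : 0 < ε) (x : M) : HasDerivAt (fun t => A t x) (derivZero A x) 0 := by
  have h := (hasDerivAt_slice_left ((hA.contDiffAt (chart_mem_atlas E x)
    (Set.mem_Ioo.2 ⟨neg_lt_zero.2 hε, hε⟩) ((chartAt E x).map_source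
      (mem_chart_source E x))).differentiableAt (by simp))).differentiableAt
  simp only [EndField.inChart_chartAt] at h
  exact h.hasDerivAt

theorem IsSmoothFormFamily.hasDerivAt_inChart {α : ℝ → Form E M k} (hα : IsSmoothFormFamily ε α)
    (hε : 0 < ε) (e : OpenPartialHomeomorph M E) (y : E) :
    HasDerivAt (fun t => (α t).inChart e y) ((formDerivZero α).inChart e y) 0 :=
  (ContinuousAlternatingMap.compContinuousLinearMapCLM (𝕜 := ℝ) (F := ℂ) (ι := Fin k)
    (chartSymmDeriv e y)).hasFDerivAt.comp_hasDerivAt (0 : ℝ) (hα.hasDerivAt hε (e.symm y))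

theorem IsSmoothEndFamily.hasDerivAt_inChart {A : ℝ → EndField E M} (hA : IsSmoothEndFamily ε A)
    (hε : 0 < ε) (e : OpenPartialHomeomorph M E) (y : E) :
    HasDerivAt (fun t => (A t).inChart e y) ((derivZero A).inChart e y) 0 := by
  have h := ((hasDerivAt_const (0 : ℝ) (chartDeriv e (e.symm y))).clm_comp
    ((hA.hasDerivAt hε (e.symm y)).clm_comp (hasDerivAt_const (0 : ℝ) (chartSymmDeriv e y))))
  simp only [ContinuousLinearMap.comp_zero, ContinuousLinearMap.zero_comp, add_zero, zero_add] at h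
  exact h

theorem IsSmoothFormFamily.isSmooth_formDerivZero {α : ℝ → Form E M k}
    (hα : IsSmoothFormFamily ε α) (hε : 0 < ε) : (formDerivZero α).IsSmooth := fun e he =>
  (contDiffOn_deriv_zero isOpen_Ioo (Set.mem_Ioo.2 ⟨neg_lt_zero.2 hε, hε⟩) e.open_target
    (hα e he)).congr fun y _ => (hα.hasDerivAt_inChart hε e y).deriv.symm

theorem IsSmoothEndFamily.contDiffOn_derivZero {A : ℝ → EndField E M}
    (hA : IsSmoothEndFamily ε A) (hε : 0 < ε) (e : OpenPartialHomeomorph M E)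
    (he : e ∈ atlas E M) : ContDiffOn ℝ ∞ ((derivZero A).inChart e) e.target :=
  (contDiffOn_deriv_zero isOpen_Ioo (Set.mem_Ioo.2 ⟨neg_lt_zero.2 hε, hε⟩) e.open_target
    (hA e he)).congr fun y _ => (hA.hasDerivAt_inChart hε e y).deriv.symm

theorem IsDeformation.derivZero_conj_linear {φ : ℝ → EndField E M} (hφ : IsDeformation ε φ)
    (hε : 0 < ε) (x : M) (v : E) :
    derivZero φ x (Complex.I • v) = -(Complex.I • derivZero φ x v) := by
  have h := hφ.smooth.hasDerivAt hε x
  have h1 := h.clm_apply (hasDerivAt_const (0 : ℝ) (Complex.I • v))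
  have h2 := (h.clm_apply (hasDerivAt_const (0 : ℝ) v)).const_smul Complex.I |>.neg
  simp only [map_zero, add_zero] at h1 h2
  refine h1.unique (h2.congr_of_eventuallyEq ?_)
  filter_upwards [Ioo_mem_nhds (neg_lt_zero.2 hε) hε] with t ht
  exact hφ.conj_linear t ht x v

variable [FiniteDimensional ℂ E]

/-- The expression in a chart of the form `π_t^p d α_t`, where `π_t^p` is the type projection for a
deformation of the complex structure, is smooth in `(t, x)`. -/
theorem IsDeformation.contDiffOn_typeProj_extDeriv {φ : ℝ → EndField E M}
    (hφ : IsDeformation ε φ) {α : ℝ → Form E M k} (hα : IsSmoothFormFamily ε α) (p : ℕ)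
    {e : OpenPartialHomeomorph M E} (he : e ∈ atlas E M) :
    ContDiffOn ℝ ∞ (fun z : ℝ × E => typeProj
      (Ring.inverse (1 + (φ z.1).inChart e z.2) * mulI E * (1 + (φ z.1).inChart e z.2)) p
      (extDeriv ((α z.1).inChart e) z.2)) (Set.Ioo (-ε) ε ×ˢ e.target) := by
  have : FiniteDimensional ℝ E := FiniteDimensional.complexToReal E
  have : CompleteSpace E := FiniteDimensional.complete ℝ E
  have hu : ∀ z ∈ Set.Ioo (-ε) ε ×ˢ e.target, IsUnit (1 + (φ z.1).inChart e z.2) := fun z hz =>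
    isUnit_one_add_inChart (hφ.isUnit z.1 hz.1) he hz.2
  have hg : ContDiffOn ℝ ∞ (fun z : ℝ × E => 1 + (φ z.1).inChart e z.2)
      (Set.Ioo (-ε) ε ×ˢ e.target) := contDiffOn_const.add (hφ.smooth e he)
  have hi : ContDiffOn ℝ ∞ (fun z : ℝ × E => Ring.inverse (1 + (φ z.1).inChart e z.2))
      (Set.Ioo (-ε) ε ×ˢ e.target) := by
    intro z hz
    obtain ⟨u, hu'⟩ := hu z hz
    have h1 := contDiffAt_ringInverse ℝ (n := ∞) u
    rw [hu'] at h1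
    exact h1.comp_contDiffWithinAt z (hg z hz)
  have hη := contDiffOn_extDeriv isOpen_Ioo e.open_target (hα e he)
  have h1 := contDiff_compContinuousLinearMap.comp_contDiffOn (hη.prodMk hi)
  have h2 := (contDiff_typeProj (mulI E) p).comp_contDiffOn h1
  have h3 := contDiff_compContinuousLinearMap.comp_contDiffOn (h2.prodMk hg)
  exact h3.congr fun z hz => typeProj_conjugate (hu z hz) (mulI E) p _

/-- The derivative at `0` of the form `π_t^p d α_t`, where `π_t^p` is the type projection for a
deformation of the complex structure. -/
def projExtDVariation (φ : ℝ → EndField E M) (α : ℝ → Form E M k) (p : ℕ) : Form E M (k + 1) :=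
  (extD (formDerivZero α)).proj (stdJ E M) p +
    substField (derivZero φ) ((extD (α 0)).proj (stdJ E M) p) -
    (substField (derivZero φ) (extD (α 0))).proj (stdJ E M) p

/-- Differentiation at `t = 0` of the equation `π_t^q d π_t^p d α_t = 0`. -/
theorem IsDeformation.proj_extD_variation {φ : ℝ → EndField E M} (hφ : IsDeformation ε φ)
    (hε : 0 < ε) {α : ℝ → Form E M k} (hα : IsSmoothFormFamily ε α)
    (hsm : ∀ t ∈ Set.Ioo (-ε) ε, (α t).IsSmooth) (p q : ℕ)
    (h : ∀ t ∈ Set.Ioo (-ε) ε,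
      (extD ((extD (α t)).proj (deformedJ (φ t)) p)).proj (deformedJ (φ t)) q = 0)
    (h0 : extD ((extD (α 0)).proj (stdJ E M) p) = 0) :
    (extD (projExtDVariation φ α p)).proj (stdJ E M) q = 0 := by
  funext x
  have hI : Set.Ioo (-ε) ε ∈ nhds (0 : ℝ) := Ioo_mem_nhds (neg_lt_zero.2 hε) hε
  have h0I : (0 : ℝ) ∈ Set.Ioo (-ε) ε := mem_of_mem_nhds hI
  have he := chart_mem_atlas E x
  have hx := (chartAt E x).map_source (mem_chart_source E x)
  set e := chartAt E x with he_def
  -- `B` is the inner form `π_t^p d α_t` read in a fixed chart, so that one jointly smooth map can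
  -- be differentiated in `t` and in `y`.
  set B : ℝ × E → E [⋀^Fin (k + 1)]→L[ℝ] ℂ := fun z => typeProj
      (Ring.inverse (1 + (φ z.1).inChart e z.2) * mulI E * (1 + (φ z.1).inChart e z.2)) p
      (extDeriv ((α z.1).inChart e) z.2) with hB
  have hBeq : ∀ t ∈ Set.Ioo (-ε) ε, ∀ y ∈ e.target,
      ((extD (α t)).proj (deformedJ (φ t)) p).inChart e y = B (t, y) := by
    intro t ht y hy
    rw [Form.inChart_proj _ _ _ he hy, inChart_deformedJ (hφ.isUnit t ht) he hy,
      inChart_extD (hsm t ht) he hy]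
  have hBext : ∀ t ∈ Set.Ioo (-ε) ε, extD ((extD (α t)).proj (deformedJ (φ t)) p) x =
      extDeriv (fun y => B (t, y)) (e x) := by
    intro t ht
    rw [extD_apply]
    exact Filter.EventuallyEq.extDeriv_eq
      (Filter.eventuallyEq_of_mem (e.open_target.mem_nhds hx) (hBeq t ht))
  have hBsm : ContDiffAt ℝ ∞ B (0, e x) :=
    (hφ.contDiffOn_typeProj_extDeriv hα p he).contDiffAt
      ((isOpen_Ioo.prod e.open_target).mem_nhds ⟨h0I, hx⟩)
  have hder := hasDerivAt_extDeriv hBsm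
  have hvar : ∀ y ∈ e.target, deriv (fun t => B (t, y)) 0 =
      (projExtDVariation φ α p).inChart e y := by
    intro y hy
    have hη := hasDerivAt_extDeriv (hα.contDiffAt he h0I hy)
    have hη' : extDeriv (fun y => deriv (fun t => (α t).inChart e y) 0) y =
        extDeriv ((formDerivZero α).inChart e) y :=
      congrArg (fun f => extDeriv f y)
        (funext fun y => (hα.hasDerivAt_inChart hε e y).deriv)
    rw [hη'] at hη
    have hψ0 : (φ 0).inChart e y = 0 := by
      rw [EndField.inChart, hφ.zero, ContinuousLinearMap.zero_comp, ContinuousLinearMap.comp_zero]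
    have hd := hasDerivAt_typeProj (mulI E) p hη (hφ.smooth.hasDerivAt_inChart hε e y) hψ0
      (Filter.mem_of_superset hI fun t ht => isUnit_one_add_inChart (hφ.isUnit t ht) he hy)
    refine hd.deriv.trans ?_
    have e1 : (projExtDVariation φ α p).inChart e y =
        ((extD (formDerivZero α)).proj (stdJ E M) p).inChart e y +
        (substField (derivZero φ) ((extD (α 0)).proj (stdJ E M) p)).inChart e y -
        ((substField (derivZero φ) (extD (α 0))).proj (stdJ E M) p).inChart e y := rfl
    rw [e1, inChart_substField _ _ he hy, Form.inChart_proj _ _ _ he hy,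
      Form.inChart_proj _ _ _ he hy, Form.inChart_proj _ _ _ he hy, inChart_substField _ _ he hy,
      inChart_stdJ he hy, inChart_extD (hsm 0 h0I) he hy,
      inChart_extD (hα.isSmooth_formDerivZero hε) he hy]
  have hvarext : extDeriv (fun y => deriv (fun t => B (t, y)) 0) (e x) =
      extD (projExtDVariation φ α p) x := by
    rw [extD_apply]
    exact Filter.EventuallyEq.extDeriv_eq
      (Filter.eventuallyEq_of_mem (e.open_target.mem_nhds hx) hvar)
  rw [hvarext] at hder
  have hζ : extDeriv (fun y => B (0, y)) (e x) = 0 := by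
    rw [← hBext 0 h0I, hφ.deformedJ_zero, h0]
    rfl
  have hfin := hasDerivAt_typeProj (mulI E) q hder (hφ.smooth.hasDerivAt hε x) (hφ.zero x)
    (Filter.mem_of_superset hI fun t ht => hφ.isUnit t ht x)
  -- Both terms from the variation of the outer projection act on `d π^p d α_0`, which is zero by
  -- `h0`.
  rw [hζ, typeProj_zero, subst_zero, typeProj_zero, sub_zero, add_zero] at hfin
  have hz : (fun t => typeProj (Ring.inverse (1 + φ t x) * mulI E * (1 + φ t x)) q
      (extDeriv (fun y => B (t, y)) (e x))) =ᶠ[nhds 0] fun _ => 0 := by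
    filter_upwards [hI] with t ht
    rw [← hBext t ht]
    exact congrFun (h t ht) x
  exact hfin.unique ((hasDerivAt_const (0 : ℝ) _).congr_of_eventuallyEq hz)

end Variation

/-! ### Fundamental forms are real and of type `(1, 1)` -/

section Reality

variable {E : Type*} [NormedAddCommGroup E] [NormedSpace ℂ E]
  {M : Type*} [TopologicalSpace M] [ChartedSpace E M]

theorem IsHermitian.conj_eq {J : EndField E M} {η : Form E M 2} (h : IsHermitian J η) :
    η.conj = η := by
  obtain ⟨-, g, -, -, -, hg⟩ := h
  funext x
  ext v
  have hv : v = ![v 0, v 1] := by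
    funext i
    fin_cases i <;> rfl
  rw [Form.conj, conjAt_apply, hv, hg, Complex.conj_ofReal]

/-- A metric invariant under `J` is invariant under every rotation `re c + im c J` with `|c| = 1`,
so its fundamental form has weight `0`. -/
theorem IsHermitian.isType {η : Form E M 2} (h : IsHermitian (stdJ E M) η) :
    η.IsType (stdJ E M) 1 := by
  obtain ⟨-, g, -, -, hJ, hg⟩ := h
  refine Form.isType_iff.2 fun x c v => ?_
  have hJ' : ∀ v w : E, g x (Complex.I • v) (Complex.I • w) = g x v w := hJ x
  have hη : ∀ v : Fin 2 → E, η x v = (g x (Complex.I • v 0) (v 1) : ℂ) := fun v => by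
    have hv : v = ![v 0, v 1] := by
      funext i
      fin_cases i <;> rfl
    conv_lhs => rw [hv]
    exact hg x _ _
  have hdec : ∀ w : E, (c : ℂ) • w = (c : ℂ).re • w + (c : ℂ).im • (Complex.I • w) := fun w => by
    rw [← Complex.coe_smul (c : ℂ).im, ← Complex.coe_smul (c : ℂ).re, smul_smul, ← add_smul,
      Complex.re_add_im]
  have hII : ∀ w : E, Complex.I • Complex.I • w = -w := fun w => by
    rw [smul_smul, Complex.I_mul_I, neg_one_smul]
  have hn : (c : ℂ).re * (c : ℂ).re + (c : ℂ).im * (c : ℂ).im = 1 := by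
    rw [← Complex.normSq_apply]
    exact Circle.normSq_coe c
  have h1 := hJ' (Complex.I • v 0) (v 1)
  rw [hη, hη, smul_comm Complex.I (c : ℂ), hdec, hdec]
  simp only [map_add, map_smul, add_apply, smul_apply, smul_eq_mul, hJ', hII, map_neg,
    neg_apply] at h1 ⊢
  rw [show (2 * ((1 : ℕ) : ℤ) - ((2 : ℕ) : ℤ)) = 0 by norm_num, zpow_zero, one_mul]
  congr 1
  linear_combination (g x (Complex.I • v 0) (v 1)) * hn +
    ((c : ℂ).im * (c : ℂ).im) * h1

end Reality


/-! ### Contraction and types -/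

section Contraction

variable {E : Type*} [NormedAddCommGroup E] [NormedSpace ℂ E] {M : Type*} {k : ℕ}

theorem Form.IsType.conj {p q : ℕ} (h : p + q = k) {α : Form E M k}
    (hα : α.IsType (stdJ E M) q) : α.conj.IsType (stdJ E M) p := by
  rw [Form.IsType, Form.proj_conj h, show α.proj (stdJ E M) q = α from hα]

theorem Form.IsType.contract {φ : EndField E M}
    (hφ : ∀ x v, φ x (Complex.I • v) = -(Complex.I • φ x v)) {p : ℕ} {α : Form E M k}
    (hα : α.IsType (stdJ E M) (p + 1)) : (contract φ α).IsType (stdJ E M) p := by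
  refine Form.isType_iff.2 fun x => ?_
  have h := (Form.isType_iff.1 hα x).contractAt (hφ x)
  rwa [show (2 * ((p + 1 : ℕ) : ℤ) - k - 2) = 2 * p - k by push_cast; ring] at h

theorem substField_eq (φ : EndField E M) (α : Form E M k) :
    substField φ α = contract φ α + (contract φ α.conj).conj :=
  funext fun x => subst_eq (φ x) (α x)

theorem substField_add (φ : EndField E M) (α β : Form E M k) :
    substField φ (α + β) = substField φ α + substField φ β := by
  funext x
  ext v
  simp only [substField, subst_apply, Pi.add_apply, ContinuousAlternatingMap.add_apply,
    Finset.sum_add_distrib]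

theorem Form.proj_sub (J : EndField E M) (p : ℕ) (α β : Form E M k) :
    (α - β).proj J p = α.proj J p - β.proj J p :=
  funext fun x => map_sub (typeProjCLM (J x) p) (α x) (β x)

end Contraction

/-! ### The variation formula for SKT metrics -/

section Main

variable {E : Type*} [NormedAddCommGroup E] [NormedSpace ℂ E]
  {M : Type*} [TopologicalSpace M] [ChartedSpace E M] [IsManifold 𝓘(ℂ, E) ∞ M]

/-- Only the `(1, 1)`-component of a `2`-form contributes to the `(2, 2)`-component of
`d π^{1,2} d`. -/
theorem del_delbar_proj {α : Form E M 2} (hα : α.IsSmooth) :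
    del (stdJ E M) 1 (delbar (stdJ E M) 1 α) =
      del (stdJ E M) 1 (delbar (stdJ E M) 1 (α.proj (stdJ E M) 1)) := by
  have h0 := Form.isType_proj 0 α
  have hsm : ∀ p, (α.proj (stdJ E M) p).IsSmooth := fun p => hα.proj p
  conv_lhs => rw [← Form.sum_proj α]
  simp only [Finset.sum_range_succ, Finset.sum_range_zero, zero_add]
  rw [delbar_add 1 ((hsm 0).add (hsm 1)) (hsm 2), delbar_add 1 (hsm 0) (hsm 1)]
  -- The differential of the `(2,0)`-part has types `(3,0)` and `(2,1)` only.
  have h2 : delbar (stdJ E M) 1 (α.proj (stdJ E M) 2) = 0 :=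
    (Form.isType_proj 2 α).proj_extD (hsm 2) (by norm_num) (by norm_num)
  -- On the `(0,2)`-part the operator `π^{1,2} d` is `∂`, so this is `∂² = 0`.
  have h1 : del (stdJ E M) 1 (delbar (stdJ E M) 1 (α.proj (stdJ E M) 0)) = 0 :=
    del_del h0 (hsm 0)
  rw [h2, add_zero, del_add 1 ((hsm 0).delbar 1) ((hsm 1).delbar 1), h1, zero_add]

variable [FiniteDimensional ℂ E]

/-- The first variation of `∂_t ∂̄_t ω_t = 0`, sorted by type. The derivative of `ω_t` need not be
of type `(1,1)`, so on the left `delbar` and `del` stand for `π^{1,2} d` and `π^{2,2} d`. -/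
theorem IsDeformation.del_delbar_formDerivZero {ε : ℝ} {φ : ℝ → EndField E M}
    (hφ : IsDeformation ε φ) (hε : 0 < ε) {α : ℝ → Form E M 2} (hα : IsSmoothFormFamily ε α)
    (hskt : ∀ t ∈ Set.Ioo (-ε) ε, IsSKT (deformedJ (φ t)) (α t)) :
    del (stdJ E M) 1 (delbar (stdJ E M) 1 (formDerivZero α)) =
      del (stdJ E M) 1 (contract (derivZero φ) (del (stdJ E M) 1 (α 0))) -
        (del (stdJ E M) 1 (contract (derivZero φ) (del (stdJ E M) 1 (α 0)))).conj := by
  have h0 := hskt 0 (Set.mem_Ioo.2 ⟨neg_lt_zero.2 hε, hε⟩)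
  rw [hφ.deformedJ_zero] at h0
  have hsm := h0.1.1
  have hty := h0.1.isType
  have hφ' := hφ.derivZero_conj_linear hε
  have hφs := hφ.smooth.contDiffOn_derivZero hε
  have hd : extD (delbar (stdJ E M) 1 (α 0)) = 0 := by
    rw [(isType_delbar 1 (α 0)).extD_eq (hsm.delbar 1), h0.2, delbar_delbar hty hsm, add_zero]
  have hvar := hφ.proj_extD_variation hε hα (fun t ht => (hskt t ht).1.1) 1 2
    (fun t ht => (hskt t ht).2) hd
  set a := del (stdJ E M) 1 (α 0) with ha
  set b := delbar (stdJ E M) 1 (α 0) with hb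
  -- Reality of `ω` makes `∂ω` and `∂̄ω` conjugate.
  have hab : a.conj = b := by
    rw [ha, hb, del, delbar, ← Form.proj_conj (p := 1) (q := 2) rfl, ← extD_conj hsm, h0.1.conj_eq]
  have hba : b.conj = a := by rw [← hab, Form.conj_conj]
  have hC : (contract (derivZero φ) a).IsSmooth := (hsm.del 1).contract hφs
  have hD : (contract (derivZero φ) b).IsSmooth := (hsm.delbar 1).contract hφs
  have tC : (contract (derivZero φ) a).IsType (stdJ E M) 1 := (isType_del 1 (α 0)).contract hφ'
  have tD : (contract (derivZero φ) b).IsType (stdJ E M) 0 := (isType_delbar 1 (α 0)).contract hφ'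
  set C := contract (derivZero φ) a with hCdef
  set D := contract (derivZero φ) b with hDdef
  have tC' : C.conj.IsType (stdJ E M) 2 := tC.conj rfl
  have tD' : D.conj.IsType (stdJ E M) 3 := tD.conj rfl
  have hZ : projExtDVariation φ α 1 =
      delbar (stdJ E M) 1 (formDerivZero α) + (D + C.conj) - C := by
    have h1 : substField (derivZero φ) b = D + C.conj := by rw [substField_eq, hba]
    -- The substitution in `dω = ∂ω + ∂̄ω` has pieces of types `(1,2)`, `(3,0)`, `(0,3)` and
    -- `(2,1)`; only the first, `C`, survives.
    have h2 : (substField (derivZero φ) (extD (α 0))).proj (stdJ E M) 1 = C := by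
      rw [hty.extD_eq hsm, substField_add, h1, substField_eq, hab, Form.proj_add, Form.proj_add,
        Form.proj_add, tD.proj_of_ne (by norm_num), tC'.proj_of_ne (by norm_num),
        tD'.proj_of_ne (by norm_num), add_zero, add_zero, add_zero]
      exact tC
    rw [projExtDVariation, h2]
    exact congrArg (fun γ => _ + γ - C) h1
  have hω := (hα.isSmooth_formDerivZero hε).delbar 1
  -- The `(2,2)`-part of `dD` vanishes since `D` has type `(0,3)`, and that of `d (conj C)` is the
  -- conjugate of `∂C`, because bidegree `(2,2)` is its own conjugate.
  rw [hZ, extD_sub (hω.add (hD.add hC.conj)) hC, extD_add hω (hD.add hC.conj),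
    extD_add hD hC.conj, extD_conj hC, Form.proj_sub, Form.proj_add, Form.proj_add,
    tD.proj_extD hD (by norm_num) (by norm_num), zero_add,
    Form.proj_conj (p := 2) (q := 2) rfl] at hvar
  rw [sub_eq_zero] at hvar
  exact eq_sub_of_add_eq hvar

end Main

end SKT

end

theorem corollary4p2
    {E : Type*} [NormedAddCommGroup E] [NormedSpace ℂ E] [FiniteDimensional ℂ E]
    {M : Type*} [TopologicalSpace M] [ChartedSpace E M] [IsManifold 𝓘(ℂ, E) ∞ M]
    [T2Space M] [CompactSpace M]
    (ω₀ : SKT.Form E M 2) (hω₀ : SKT.IsHermitian (SKT.stdJ E M) ω₀)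
    (ε : ℝ) (hε : 0 < ε)
    (φ : ℝ → SKT.EndField E M) (hφ : SKT.IsDeformation ε φ)
    (hex : ∃ ωt : ℝ → SKT.Form E M 2, SKT.IsSmoothFormFamily ε ωt ∧
      (∀ t ∈ Set.Ioo (-ε) ε, SKT.IsSKT (SKT.deformedJ (φ t)) (ωt t)) ∧ ωt 0 = ω₀) :
    ∃ hcl : (SKT.del (SKT.stdJ E M) 1
        (SKT.contract (SKT.derivZero φ) (SKT.del (SKT.stdJ E M) 1 ω₀))).im ∈
          SKT.bcClosed E M 4 2,
      (SKT.BottChern.mk _ hcl : SKT.BottChern E M 1 1) = 0 := by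
  obtain ⟨ωt, hsm, hskt, rfl⟩ := hex
  have hω' := hsm.isSmooth_formDerivZero hε
  -- The potential is the `(1,1)`-part of `ω'`; the factor `1 / 2i` is the one in `Im β = (β - conj
  -- β) / 2i`.
  have hψ : (1 / (2 * Complex.I)) • (SKT.formDerivZero ωt).proj (SKT.stdJ E M) 1 ∈
      SKT.formsOfType E M 2 1 :=
    Submodule.smul_mem _ _ ⟨hω'.proj 1, SKT.Form.isType_proj 1 _⟩
  have h : SKT.del (SKT.stdJ E M) 1 (SKT.delbar (SKT.stdJ E M) 1
      ((1 / (2 * Complex.I)) • (SKT.formDerivZero ωt).proj (SKT.stdJ E M) 1)) =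
      (SKT.del (SKT.stdJ E M) 1
        (SKT.contract (SKT.derivZero φ) (SKT.del (SKT.stdJ E M) 1 (ωt 0)))).im := by
    rw [SKT.delbar_smul, SKT.del_smul, ← SKT.del_delbar_proj hω',
      hφ.del_delbar_formDerivZero hε hsm hskt, SKT.Form.im_eq]
  -- Closedness is read off from `∂∂̄`-exactness, so the one identity `h` gives both claims.
  refine ⟨h ▸ SKT.del_delbar_mem_bcClosed hψ, ?_⟩
  exact (Submodule.Quotient.mk_eq_zero _).2 ⟨_, hψ, h⟩
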